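/- **Setting.** Let $\mathbb F$ be a field and let $0\neq q\in\mathbb F$ be not a root of unity. Write $[X,Y]=XY-YX$ and $[X,Y]_q=qXY-q^{-1}YX$. The $q$-Onsager algebra $\mathcal O_q$ is the unital associative $\mathbb F$-algebra with generators $A,A^*$ and relations $$[A,[A,[A,A^*]_q]_{q^{-1}}]=(q^2-q^{-2})^2[A^*,A],\qquad [A^*,[A^*,[A^*,A]_q]_{q^{-1}}]=(q^2-q^{-2})^2[A,A^*].$$ Let $L$ be the Lusztig automorphism of $\mathcal O_q$, which fixes $A$ and sends $A^*$ to $A^*+\frac{[A,[A,A^*]_q]}{(q-q^{-1})(q^2-q^{-2})}$; thus $$L^{-1}(A^*)=A^*+\frac{[A,[A,A^*]_{q^{-1}}]}{(q-q^{-1})(q^2-q^{-2})}.$$ Let $V$ be an irreducible $\mathcal O_q$-module with $2\le\dim_{\mathbb F}V<\infty$ on which each of $A,A^*$ is diagonalizable. An *equitable triple* on $V$ is a triple $X,Y,Z$ of invertible elements of $\mathrm{End}(V)$ with $$\frac{qXY-q^{-1}YX}{q-q^{-1}}=\frac{qYZ-q^{-1}ZY}{q-q^{-1}}=\frac{qZX-q^{-1}XZ}{q-q^{-1}}=I.$$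 Call scalars $\lambda\ne\mu$ *adjacent* if $\lambda^2-(q^2+q^{-2})\lambda\mu+\mu^2+(q^2-q^{-2})^2=0$, and call an ordering of the eigenvalues of a linear map *standard* if consecutive eigenvalues are adjacent. **Diagram.** A decomposition of $V$ is a sequence $\{W_i\}_{i=0}^d$ of nonzero subspaces whose direct sum is $V$; its corresponding map is the $M\in\mathrm{End}(V)$ that acts on $W_i$ as $q^{d-2i}$ for $0\le i\le d$. Given standard orderings $\{\theta_i\}_{i=0}^d$, $\{\theta^*_i\}_{i=0}^d$ of the eigenvalues of $A$ and of $A^*$ on $V$, let $V_i$, $V_i^*$, $V_i^-$ be the $\theta_i$-eigenspace of $A$, the $\theta^*_i$-eigenspace of $A^*$ and the $\theta_i^*$-eigenspace of $L^{-1}(A^*)$. Take six vertices $u$, each carrying a flag $F_0(u)\subseteq\cdots\subseteq F_d(u)$: * $t$ with $F_i(t)=V^*_0+\cdots+V^*_i$, and $t'$ with $F_i(t')=V^*_d+\cdots+V^*_{d-i}$; * $m$ with $F_i(m)=V_0+\cdots+V_i$, and $m'$ with $F_i(m')=V_d+\cdots+V_{d-i}$; * $b$ with $F_i(b)=V^-_0+\cdots+V^-_i$,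 and $b'$ with $F_i(b')=V^-_d+\cdots+V^-_{d-i}$. The oriented edges are $$t\to m,\quad t\to m',\quad t'\to m,\quad t'\to m',\quad m\to b,\quad m'\to b,\quad m\to b',\quad m'\to b',\quad b\to t,\quad b'\to t'.$$ An edge $u\to v$ represents the decomposition $\{W_i\}_{i=0}^d$ of $V$ with $W_0+\cdots+W_i=F_i(u)$ and $W_d+\cdots+W_{d-i}=F_i(v)$ for $0\le i\le d$; the map of the edge is the map corresponding to this decomposition. **Theorem.** The eigenvalues of $A$ and of $A^*$ on $V$ have standard orderings, both of the same length $d+1$. For any such orderings $\{\theta_i\}_{i=0}^d$, $\{\theta^*_i\}_{i=0}^d$ the following hold. 1. The diagram is well defined: each of $\{V_i\}_{i=0}^d$, $\{V_i^*\}_{i=0}^d$, $\{V_i^-\}_{i=0}^d$ is a decomposition of $V$, and each oriented edge represents exactly one decomposition of $V$. 2. For each oriented 3-cycle $u\to v\to w\to u$ in the diagram, the maps of the edges $u\to v$, $v\to w$, $w\to u$, in this order, form an equitable triple on $V$. 3. There is a nonzero $a\in\mathbb F$ with $a\neq a^{-1}$ and $\theta_i=aq^{d-2i}+a^{-1}q^{2i-d}$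 for $0\le i\le d$, such that the following holds. Let $K,B,K^\downarrow,B^\downarrow$ be the maps of $t\to m'$, $t\to m$, $t'\to m'$, $t'\to m$. Then $$M=\frac{aK-a^{-1}B}{a-a^{-1}},\qquad M^\downarrow=\frac{aK^\downarrow-a^{-1}B^\downarrow}{a-a^{-1}}$$ are invertible, and the maps of the remaining edges are $$\begin{aligned} m'\to b&:\ aA-a^2K, & m\to b&:\ a^{-1}A-a^{-2}B, & b\to t&:\ M^{-1},\\ m'\to b'&:\ aA-a^2K^\downarrow, & m\to b'&:\ a^{-1}A-a^{-2}B^\downarrow, & b'\to t'&:\ (M^\downarrow)^{-1}.\end{aligned}$$ Consequently the four oriented 3-cycles give the equitable triples $$\begin{aligned}&aA-a^2K,\ M^{-1},\ K; && a^{-1}A-a^{-2}B,\ M^{-1},\ B;\\ &aA-a^2K^\downarrow,\ (M^\downarrow)^{-1},\ K^\downarrow; && a^{-1}A-a^{-2}B^\downarrow,\ (M^\downarrow)^{-1},\ B^\downarrow.\end{aligned}$$ -/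

import Mathlib

open Module

/-! ### The `q`-Onsager algebra and the Lusztig automorphism -/

/-- The `q`-commutator `[X, Y]_q = q X Y - q⁻¹ Y X` in an `F`-algebra. -/
def qComm {F R : Type*} [Field F] [Ring R] [Algebra F R] (q : F) (X Y : R) : R :=
  q • (X * Y) - q⁻¹ • (Y * X)

/-- Names of the two generators of the `q`-Onsager algebra. -/
inductive OnsagerGen : Type
  | A
  | Astar

/-- The two `q`-Dolan/Grady relations (`⁅X, Y⁆ = X * Y - Y * X` is the ring commutator). -/
inductive DolanGrady {F : Type*} [Field F] (q : F) :
    FreeAlgebra F OnsagerGen → FreeAlgebra F OnsagerGen → Prop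
  | dg1 : DolanGrady q
      ⁅FreeAlgebra.ι F OnsagerGen.A,
        qComm q⁻¹ (FreeAlgebra.ι F OnsagerGen.A)
          (qComm q (FreeAlgebra.ι F OnsagerGen.A) (FreeAlgebra.ι F OnsagerGen.Astar))⁆
      ((q ^ 2 - (q ^ 2)⁻¹) ^ 2 •
        ⁅FreeAlgebra.ι F OnsagerGen.Astar, FreeAlgebra.ι F OnsagerGen.A⁆)
  | dg2 : DolanGrady q
      ⁅FreeAlgebra.ι F OnsagerGen.Astar,
        qComm q⁻¹ (FreeAlgebra.ι F OnsagerGen.Astar)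
          (qComm q (FreeAlgebra.ι F OnsagerGen.Astar) (FreeAlgebra.ι F OnsagerGen.A))⁆
      ((q ^ 2 - (q ^ 2)⁻¹) ^ 2 •
        ⁅FreeAlgebra.ι F OnsagerGen.A, FreeAlgebra.ι F OnsagerGen.Astar⁆)

/-- The `q`-Onsager algebra `O_q` over `F`, by generators and relations. -/
abbrev QOnsager {F : Type*} [Field F] (q : F) : Type _ := RingQuot (DolanGrady q)

namespace QOnsager

/-- The generator `A` of `O_q`. -/
noncomputable def A {F : Type*} [Field F] (q : F) : QOnsager q :=
  RingQuot.mkAlgHom F (DolanGrady q) (FreeAlgebra.ι F OnsagerGen.A)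

/-- The generator `A*` of `O_q`. -/
noncomputable def Astar {F : Type*} [Field F] (q : F) : QOnsager q :=
  RingQuot.mkAlgHom F (DolanGrady q) (FreeAlgebra.ι F OnsagerGen.Astar)

/-- The defining property of the Lusztig automorphism `L` of `O_q`: it fixes `A` and sends `A*` to
`A* + [A, [A, A*]_q] / ((q - q⁻¹)(q² - q⁻²))`. -/
def IsLusztig {F : Type*} [Field F] (q : F) (L : QOnsager q ≃ₐ[F] QOnsager q) : Prop :=
  L (A q) = A q ∧
  L (Astar q) = Astar q +
    ((q - q⁻¹) * (q ^ 2 - (q ^ 2)⁻¹))⁻¹ • ⁅A q, qComm q (A q) (Astar q)⁆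

/-- The element `L⁻¹(A*) = A* + [A, [A, A*]_{q⁻¹}] / ((q - q⁻¹)(q² - q⁻²))` of `O_q`, where `L` is
the Lusztig automorphism; see `IsLusztig.symm_Astar`. -/
noncomputable def LinvAstar {F : Type*} [Field F] (q : F) : QOnsager q :=
  Astar q + ((q - q⁻¹) * (q ^ 2 - (q ^ 2)⁻¹))⁻¹ • ⁅A q, qComm q⁻¹ (A q) (Astar q)⁆

theorem dolanGrady₁ {F : Type*} [Field F] (q : F) :
    ⁅A q, qComm q⁻¹ (A q) (qComm q (A q) (Astar q))⁆ =
      (q ^ 2 - (q ^ 2)⁻¹) ^ 2 • ⁅Astar q, A q⁆ := by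
  have h := RingQuot.mkAlgHom_rel F (DolanGrady.dg1 (q := q))
  simpa only [qComm, Ring.lie_def, map_sub, map_mul, map_smul, A, Astar] using h

/-- Justification of the definition of `LinvAstar`: it is the preimage of `A*` under the Lusztig
automorphism. -/
theorem IsLusztig.symm_Astar {F : Type*} [Field F] {q : F} (hq0 : q ≠ 0) (hq : q ^ 4 ≠ 1)
    {L : QOnsager q ≃ₐ[F] QOnsager q} (hL : IsLusztig q L) :
    L.symm (Astar q) = LinvAstar q := by
  rw [AlgEquiv.symm_apply_eq]
  have h := dolanGrady₁ q
  obtain ⟨h1, h2⟩ := hL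
  have hk : ((q - q⁻¹) * (q ^ 2 - (q ^ 2)⁻¹)) ≠ 0 := by
    have e : (q - q⁻¹) * (q ^ 2 - (q ^ 2)⁻¹) * (q + q⁻¹) = (q ^ 4 - 1) ^ 2 / q ^ 4 := by
      field_simp
      ring
    intro h0
    rw [h0, zero_mul] at e
    have : (q ^ 4 - 1) ^ 2 / q ^ 4 ≠ 0 :=
      div_ne_zero (pow_ne_zero _ (sub_ne_zero.2 hq)) (pow_ne_zero _ hq0)
    exact this e.symm
  have hc : (q ^ 2 - (q ^ 2)⁻¹) ^ 2 = ((q - q⁻¹) * (q ^ 2 - (q ^ 2)⁻¹)) * (q + q⁻¹) := by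
    field_simp
    ring
  rw [hc] at h
  simp only [LinvAstar, qComm, Ring.lie_def, map_add, map_sub, map_mul, map_smul, h1, h2] at h ⊢
  generalize (q - q⁻¹) * (q ^ 2 - (q ^ 2)⁻¹) = k at *
  generalize A q = a at *
  generalize Astar q = b at *
  have h' := congrArg (fun x => (k⁻¹ * k⁻¹) • (a * x - x * a)) h
  simp only [mul_sub, sub_mul, mul_add, add_mul, mul_smul_comm, smul_mul_assoc, mul_assoc] at h' ⊢
  rw [← sub_eq_zero] at h' ⊢
  rw [← neg_eq_zero, ← h']
  match_scalars <;> field_simp <;> ring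

end QOnsager

/-! ### Diagonalizable maps and standard orderings of eigenvalues -/

/-- `T` is diagonalizable: `V` is spanned by eigenvectors of `T`. -/
def IsDiagonalizable {F V : Type*} [Field F] [AddCommGroup V] [Module F V] (T : End F V) : Prop :=
  ⨆ μ : F, T.eigenspace μ = ⊤

/-- Adjacency of scalars: `λ ≠ μ` and `λ² - (q² + q⁻²) λ μ + μ² + (q² - q⁻²)² = 0`. -/
def Adjacent {F : Type*} [Field F] (q x y : F) : Prop :=
  x ≠ y ∧ x ^ 2 - (q ^ 2 + (q ^ 2)⁻¹) * x * y + y ^ 2 + (q ^ 2 - (q ^ 2)⁻¹) ^ 2 = 0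

/-- `θ 0, …, θ d` is an ordering of the (mutually distinct) eigenvalues of `T` in which consecutive
eigenvalues are adjacent. -/
def IsStandardOrdering {F V : Type*} [Field F] [AddCommGroup V] [Module F V] (q : F)
    (T : End F V) {d : ℕ} (θ : Fin (d + 1) → F) : Prop :=
  Function.Injective θ ∧ Set.range θ = {μ | T.HasEigenvalue μ} ∧
    ∀ i : Fin d, Adjacent q (θ i.castSucc) (θ i.succ)

/-! ### Decompositions and their diagrams -/

/-- A decomposition of `V`: a sequence of nonzero subspaces whose direct sum is `V`. -/
def IsDecomposition {F V : Type*} [Field F] [AddCommGroup V] [Module F V] {d : ℕ}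
    (W : Fin (d + 1) → Submodule F V) : Prop :=
  DirectSum.IsInternal W ∧ ∀ i, W i ≠ ⊥

/-- The inversion `W d, …, W 0` of the sequence `W 0, …, W d`. -/
def inversion {F V : Type*} [Field F] [AddCommGroup V] [Module F V] {d : ℕ}
    (W : Fin (d + 1) → Submodule F V) : Fin (d + 1) → Submodule F V :=
  fun i => W i.rev

/-- The partial sums `W 0 + W 1 + ⋯ + W i`. -/
def partialSum {F V : Type*} [Field F] [AddCommGroup V] [Module F V] {d : ℕ}
    (W : Fin (d + 1) → Submodule F V) (i : Fin (d + 1)) : Submodule F V :=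
  ⨆ j ≤ i, W j

/-- `M` is the map corresponding to the decomposition `W`: `(M - q^(d-2i) I) W i = 0` for all `i`. -/
def IsCorrespondingMap {F V : Type*} [Field F] [AddCommGroup V] [Module F V] (q : F) {d : ℕ}
    (W : Fin (d + 1) → Submodule F V) (M : End F V) : Prop :=
  ∀ i, ∀ w ∈ W i, M w = q ^ ((d : ℤ) - 2 * (i : ℤ)) • w

/-- The six vertices of the diagram: the left and right ends of the horizontal segments for
`A*` (top), `A` (middle) and `L⁻¹(A*)` (bottom). -/
inductive DVertex : Type
  | topL
  | topR
  | midL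
  | midR
  | botL
  | botR

/-- The oriented edges of the diagram (the three horizontal segments are not oriented). The
diagonal edges point downwards and the two vertical edges point upwards. -/
inductive DEdge : DVertex → DVertex → Prop
  | topL_midL : DEdge .topL .midL
  | topL_midR : DEdge .topL .midR
  | topR_midL : DEdge .topR .midL
  | topR_midR : DEdge .topR .midR
  | midL_botL : DEdge .midL .botL
  | midR_botL : DEdge .midR .botL
  | midL_botR : DEdge .midL .botR
  | midR_botR : DEdge .midR .botR
  | botL_topL : DEdge .botL .topL
  | botR_topR : DEdge .botR .topR

/-- The flag attached to a vertex, given the decompositions `VA`, `VAs`, `VLi` on the three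
horizontal segments (middle, top, bottom), each drawn from left to right. -/
def vertexFlag {F V : Type*} [Field F] [AddCommGroup V] [Module F V] {d : ℕ}
    (VA VAs VLi : Fin (d + 1) → Submodule F V) : DVertex → Fin (d + 1) → Submodule F V
  | .topL => partialSum VAs
  | .topR => partialSum (inversion VAs)
  | .midL => partialSum VA
  | .midR => partialSum (inversion VA)
  | .botL => partialSum VLi
  | .botR => partialSum (inversion VLi)

/-- `W` is a decomposition of `V` that can be drawn along a segment from the vertex `u` to the
vertex `v`: read from `u` its partial sums are the flag at `u`, read from `v` they are the flag
at `v`. -/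
def IsSegment {F V : Type*} [Field F] [AddCommGroup V] [Module F V] {d : ℕ}
    (VA VAs VLi : Fin (d + 1) → Submodule F V) (u v : DVertex)
    (W : Fin (d + 1) → Submodule F V) : Prop :=
  IsDecomposition W ∧ partialSum W = vertexFlag VA VAs VLi u ∧
    partialSum (inversion W) = vertexFlag VA VAs VLi v

/-- `M` is the map corresponding to (the decomposition drawn along) the segment from `u` to `v`. -/
def IsSegmentMap {F V : Type*} [Field F] [AddCommGroup V] [Module F V] (q : F) {d : ℕ}
    (VA VAs VLi : Fin (d + 1) → Submodule F V) (u v : DVertex) (M : End F V) : Prop :=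
  ∃ W, IsSegment VA VAs VLi u v W ∧ IsCorrespondingMap q W M

/-! ### Equitable triples -/

/-- The `q`-Weyl relation `(q X Y - q⁻¹ Y X) / (q - q⁻¹) = I`. -/
def QWeyl {F V : Type*} [Field F] [AddCommGroup V] [Module F V] (q : F) (X Y : End F V) : Prop :=
  (q - q⁻¹)⁻¹ • qComm q X Y = 1

/-- An equitable triple on `V`. -/
def IsEquitableTriple {F V : Type*} [Field F] [AddCommGroup V] [Module F V] (q : F)
    (X Y Z : End F V) : Prop :=
  IsUnit X ∧ IsUnit Y ∧ IsUnit Z ∧ QWeyl q X Y ∧ QWeyl q Y Z ∧ QWeyl q Z X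

/-! Edge maps are recognized by their diagonal action on flags. If a map induces q^(d-2i) on the
i-th quotient of one flag and q^(2i-d) on the i-th quotient of another, then, these scalars being
distinct, it is the map of a decomposition joining the two flags (`joins_eigenspace`). Such a
decomposition is unique (`Joins.eq_oppositeInf`). Diagonal actions are easy to follow through sums,
products, inverses and conjugation.

The q-Dolan/Grady relations let A* move an eigenspace of A only into itself and adjacent ones, and
likewise with A and A* exchanged. Irreducibility then yields the standard orderings and makes each
flag of A* opposite to each flag of A (`IsOnsagerPair.antidiagonalSum_eq`). This produces K and B,
and K satisfies qKA - q⁻¹AK = (q - q⁻¹)(aK² + a⁻¹) (`qComm_of_acts`), as does B with a⁻¹ in place of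
a.

On V the inverse Lusztig automorphism sends A* to H⁻¹A*H, where H is a scalar on each eigenspace of
A (`IsOnsagerPair.exists_conj`). So H⁻¹ carries the top flags to the bottom flags and fixes the
middle ones. The central identity is aA - a²K = H⁻¹K⁻¹H (`sub_eq_conj_inv`): K⁻¹ runs from m' to t,
hence its conjugate runs from m' to b. Both sides satisfy one quadratic relation with A and agree to
second order along the flag of A, which forces equality.

Up to one normalizing factor, M is both a combination of K and B and the same kind of combination of
the two maps ending at b, because A cancels. So M acts diagonally on both the top and the bottom
flag, and M⁻¹ is the vertical map. The remaining q-Weyl relations have proportional defects, one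
lowering the top flag and the other the bottom flag; these flags are opposite, so the defects vanish
(`qComm_eq_sq`). -/

/-! ### Flags, diagonal actions on them, and opposite flags. -/

section Flags

variable {F V : Type*} [Field F] [AddCommGroup V] [Module F V]

/-- The flag `W 0 + ⋯ + W (n - 1)` of a sequence of subspaces, indexed by natural numbers. -/
def levelFlag {d : ℕ} (W : Fin (d + 1) → Submodule F V) (n : ℕ) : Submodule F V :=
  ⨆ j : Fin (d + 1), ⨆ _ : (j : ℕ) < n, W j

/-- A strictly increasing flag `0 = E 0 < E 1 < ⋯ < E (d + 1) = V`. -/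
structure IsFlag (d : ℕ) (E : ℕ → Submodule F V) : Prop where
  mono : Monotone E
  zero : E 0 = ⊥
  top : E (d + 1) = ⊤
  strict : ∀ i ≤ d, ¬ E (i + 1) ≤ E i

/-- `M` stabilizes the flag `E` and acts on the `i`-th quotient as the scalar `κ i`. -/
def ActsOn (E : ℕ → Submodule F V) (M : End F V) (κ : ℕ → F) : Prop :=
  ∀ i, ∀ v ∈ E (i + 1), M v - κ i • v ∈ E i

namespace ActsOn

variable {E : ℕ → Submodule F V} {M N : End F V} {κ l : ℕ → F}

theorem map_mem (h : ActsOn E M κ) (hm : Monotone E) (h0 : E 0 = ⊥) {i : ℕ} {v : V}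
    (hv : v ∈ E i) : M v ∈ E i := by
  cases i with
  | zero =>
    rw [h0, Submodule.mem_bot] at hv ⊢
    rw [hv, map_zero]
  | succ i =>
    have := (E (i + 1)).add_mem (hm (Nat.le_succ i) (h i v hv)) ((E (i + 1)).smul_mem (κ i) hv)
    simpa using this

theorem congr (h : ActsOn E M κ) (e : ∀ i, κ i = l i) : ActsOn E M l := by
  rwa [← funext e]

theorem sub (h : ActsOn E M κ) (h' : ActsOn E N l) : ActsOn E (M - N) (fun i => κ i - l i) := by
  intro i v hv
  have := (E i).sub_mem (h i v hv) (h' i v hv)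
  convert this using 1
  simp only [LinearMap.sub_apply]
  module

theorem smul (h : ActsOn E M κ) (c : F) : ActsOn E (c • M) (fun i => c * κ i) := by
  intro i v hv
  have := (E i).smul_mem c (h i v hv)
  convert this using 1
  simp only [LinearMap.smul_apply]
  module

theorem mul (h : ActsOn E M κ) (h' : ActsOn E N l) (hm : Monotone E) (h0 : E 0 = ⊥) :
    ActsOn E (M * N) (fun i => κ i * l i) := by
  intro i v hv
  have := (E i).add_mem (h.map_mem hm h0 (h' i v hv)) ((E i).smul_mem (l i) (h i v hv))
  convert this using 1
  simp only [Module.End.mul_apply, map_sub, map_smul]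
  module

/-- Apply `N` to the congruence for `M`: stability of `E i` under `N` gives the congruence one level
up, which gives stability of `E (i + 1)`. -/
theorem inv (h : ActsOn E M κ) (h0 : E 0 = ⊥) (hκ : ∀ i, κ i ≠ 0) (hm : Monotone E)
    (hNM : N * M = 1) : ActsOn E N (fun i => (κ i)⁻¹) := by
  have key : ∀ i, (∀ v ∈ E i, N v ∈ E i) → ∀ v ∈ E (i + 1), N v - (κ i)⁻¹ • v ∈ E i := by
    intro i hi v hv
    have := (E i).smul_mem (-(κ i)⁻¹) (hi _ (h i v hv))
    convert this using 1
    have e : N (M v) = v := by rw [← Module.End.mul_apply, hNM, Module.End.one_apply]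
    rw [map_sub, map_smul, e, smul_sub, smul_smul, neg_mul, inv_mul_cancel₀ (hκ i)]
    module
  have stab : ∀ i, ∀ v ∈ E i, N v ∈ E i := by
    intro i
    induction i with
    | zero =>
      intro v hv
      rw [h0, Submodule.mem_bot] at hv ⊢
      rw [hv, map_zero]
    | succ i ih =>
      intro v hv
      have := (E (i + 1)).add_mem (hm (Nat.le_succ i) (key i ih v hv))
        ((E (i + 1)).smul_mem (κ i)⁻¹ hv)
      simpa using this
  exact fun i => key i (stab i)

/-- A kernel vector slides down the flag, since no quotient carries the scalar zero. -/
theorem isUnit [FiniteDimensional F V] (h : ActsOn E M κ) (h0 : E 0 = ⊥) {n : ℕ}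
    (ht : E n = ⊤) (hκ : ∀ i, κ i ≠ 0) : IsUnit M := by
  rw [LinearMap.isUnit_iff_ker_eq_bot, LinearMap.ker_eq_bot']
  have : ∀ i, ∀ v ∈ E i, M v = 0 → v = 0 := by
    intro i
    induction i with
    | zero => intro v hv _; rwa [h0, Submodule.mem_bot] at hv
    | succ i ih =>
      intro v hv hv0
      refine ih v ?_ hv0
      have := h i v hv
      rw [hv0, zero_sub, neg_mem_iff] at this
      exact (Submodule.smul_mem_iff _ (hκ i)).1 this
  exact fun v => this n v (ht ▸ Submodule.mem_top)

theorem conj {H H' : End F V} (h : ActsOn E M κ) (hH : H * H' = 1) :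
    ActsOn (fun n => (E n).map H') (H' * M * H) κ := by
  rintro i _ ⟨v, hv, rfl⟩
  have e : H (H' v) = v := by rw [← Module.End.mul_apply, hH, Module.End.one_apply]
  refine ⟨_, h i v hv, ?_⟩
  simp only [Module.End.mul_apply, map_sub, map_smul, e]

end ActsOn

/-- If `M` acts on a flag by distinct scalars, the flag consists of partial sums of
eigenspaces of `M`. -/
theorem ActsOn.levelFlag_eigenspace {E : ℕ → Submodule F V} {M : End F V} {κ : ℕ → F} {d : ℕ}
    (h : ActsOn E M κ) (hE : IsFlag d E)
    (hκ : ∀ i ≤ d, ∀ j ≤ d, κ i = κ j → i = j) {n : ℕ} (hn : n ≤ d + 1) :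
    levelFlag (fun i : Fin (d + 1) => M.eigenspace (κ i)) n = E n := by
  apply le_antisymm
  · refine iSup₂_le fun j hj v hv => ?_
    rw [Module.End.mem_eigenspace_iff] at hv
    -- Descend from `E (d + 1) = V`: on every quotient above the `j`-th the scalar differs from `κ
    -- j`, so the eigenvector has no component there.
    have : ∀ m, (j : ℕ) + 1 + m ≤ d + 1 → v ∈ E (d + 1 - m) := by
      intro m
      induction m with
      | zero => intro _; rw [Nat.sub_zero, hE.top]; trivial
      | succ m ih =>
        intro hm
        have h1 := ih (by omega)
        obtain ⟨p, hp⟩ : ∃ p, d + 1 - m = p + 1 := ⟨d - m, by omega⟩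
        have hp' : d + 1 - (m + 1) = p := by omega
        rw [hp] at h1
        rw [hp']
        have h2 := h p v h1
        rw [hv, ← sub_smul] at h2
        refine (Submodule.smul_mem_iff _ (sub_ne_zero.2 fun e => ?_)).1 h2
        have := hκ _ (by omega) _ (by omega) e
        omega
    have h3 := this (d - j) (by omega)
    exact hE.mono (by omega) h3
  · induction n with
    | zero => rw [hE.zero]; exact bot_le
    | succ n ih =>
      have ih := ih (by omega)
      intro v hv
      have hu := ih (h n v hv)
      -- On the sum of the earlier eigenspaces `M - κ n` is onto, so `v` can be corrected by some
      -- `u` there to an eigenvector for `κ n`.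
      have key : levelFlag (fun i : Fin (d + 1) => M.eigenspace (κ i)) n ≤
          (levelFlag (fun i : Fin (d + 1) => M.eigenspace (κ i)) n).map
            (M - κ n • (1 : End F V)) := by
        refine iSup₂_le fun j hj w hw => ?_
        have hw' := hw
        rw [Module.End.mem_eigenspace_iff] at hw'
        have hne : κ j - κ n ≠ 0 := by
          refine sub_ne_zero.2 fun e => ?_
          have := hκ _ (by omega) _ (by omega) e
          omega
        refine ⟨(κ j - κ n)⁻¹ • w, ?_, ?_⟩
        · exact Submodule.smul_mem _ _ (Submodule.mem_iSup_of_mem j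
            (Submodule.mem_iSup_of_mem hj hw))
        · simp only [map_smul, LinearMap.sub_apply, hw', LinearMap.smul_apply,
            Module.End.one_apply]
          rw [← sub_smul, smul_smul, inv_mul_cancel₀ hne, one_smul]
      obtain ⟨u, hu1, hu2⟩ := key hu
      have hle : levelFlag (fun i : Fin (d + 1) => M.eigenspace (κ i)) n ≤
          levelFlag (fun i : Fin (d + 1) => M.eigenspace (κ i)) (n + 1) :=
        iSup_mono fun j => iSup_mono' fun hj => ⟨by omega, le_rfl⟩
      have h1 : v - u ∈ M.eigenspace (κ n) := by
        rw [Module.End.mem_eigenspace_iff]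
        simp only [LinearMap.sub_apply, LinearMap.smul_apply, Module.End.one_apply] at hu2
        rw [map_sub, smul_sub, sub_eq_sub_iff_sub_eq_sub, ← hu2]
      have h2 : M.eigenspace (κ n) ≤
          levelFlag (fun i : Fin (d + 1) => M.eigenspace (κ i)) (n + 1) :=
        le_iSup₂_of_le (⟨n, by omega⟩ : Fin (d + 1)) (Nat.lt_succ_self n) le_rfl
      have := Submodule.add_mem _ (h2 h1) (hle hu1)
      simpa using this

theorem levelFlag_mono {d : ℕ} (W : Fin (d + 1) → Submodule F V) : Monotone (levelFlag W) :=
  fun _ _ h => iSup_mono fun _ => iSup_mono' fun hj => ⟨lt_of_lt_of_le hj h, le_rfl⟩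

theorem levelFlag_zero {d : ℕ} (W : Fin (d + 1) → Submodule F V) : levelFlag W 0 = ⊥ := by
  simp [levelFlag]

theorem levelFlag_of_lt {d : ℕ} (W : Fin (d + 1) → Submodule F V) {n : ℕ} (hn : d < n) :
    levelFlag W n = ⨆ j, W j :=
  iSup_congr fun j => iSup_pos (by omega)

theorem le_levelFlag {d : ℕ} (W : Fin (d + 1) → Submodule F V) {j : Fin (d + 1)} {n : ℕ}
    (h : (j : ℕ) < n) : W j ≤ levelFlag W n :=
  le_iSup₂_of_le j h le_rfl

theorem partialSum_eq_levelFlag {d : ℕ} (W : Fin (d + 1) → Submodule F V) (i : Fin (d + 1)) :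
    partialSum W i = levelFlag W (i + 1) := by
  refine iSup_congr fun j => iSup_congr_Prop ?_ fun _ => rfl
  rw [Fin.le_def]; omega

theorem partialSum_eq_iff {d : ℕ} {W W' : Fin (d + 1) → Submodule F V} :
    partialSum W = partialSum W' ↔ ∀ n ≤ d + 1, levelFlag W n = levelFlag W' n := by
  constructor
  · intro h n hn
    cases n with
    | zero => rw [levelFlag_zero, levelFlag_zero]
    | succ n =>
      have := congrFun h ⟨n, by omega⟩
      rwa [partialSum_eq_levelFlag, partialSum_eq_levelFlag] at this
  · intro h
    funext i
    rw [partialSum_eq_levelFlag, partialSum_eq_levelFlag]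
    exact h _ (by omega)

theorem IsDecomposition.iSup_eq_top {d : ℕ} {W : Fin (d + 1) → Submodule F V}
    (h : IsDecomposition W) : ⨆ j, W j = ⊤ :=
  h.1.submodule_iSup_eq_top

theorem IsDecomposition.disjoint_levelFlag {d : ℕ} {W : Fin (d + 1) → Submodule F V}
    (h : IsDecomposition W) {n m : ℕ} (hnm : n + m ≤ d + 1) :
    Disjoint (levelFlag W n) (levelFlag (inversion W) m) := by
  have h1 := h.1.submodule_iSupIndep
  have h2 := h1.disjoint_biSup_biSup (s := {j : Fin (d + 1) | (j : ℕ) < n})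
      (t := {j : Fin (d + 1) | (j.rev : ℕ) < m}) (by
    rw [Set.disjoint_left]
    intro j hj hj'
    simp only [Set.mem_ofPred_eq, Fin.val_rev] at hj hj'
    omega)
  refine h2.mono le_rfl (iSup₂_le fun j hj => ?_)
  refine le_iSup₂_of_le j.rev ?_ le_rfl
  change (j.rev.rev : ℕ) < m
  rwa [Fin.rev_rev]

theorem IsDecomposition.isFlag {d : ℕ} {W : Fin (d + 1) → Submodule F V}
    (h : IsDecomposition W) : IsFlag d (levelFlag W) where
  mono := levelFlag_mono W
  zero := levelFlag_zero W
  top := by rw [levelFlag_of_lt W (Nat.lt_succ_self d), h.iSup_eq_top]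
  strict := by
    intro i hi hle
    have h1 := h.disjoint_levelFlag (n := i) (m := d + 1 - i) (by omega)
    have h2 := le_levelFlag W (j := ⟨i, by omega⟩) (Nat.lt_succ_self i)
    have h3 := le_levelFlag (inversion W) (j := Fin.rev ⟨i, by omega⟩) (n := d + 1 - i)
      (by simp only [Fin.val_rev]; omega)
    simp only [inversion, Fin.rev_rev] at h3
    exact h.2 _ (le_bot_iff.1 (h1 (h2.trans hle) h3))

theorem IsDecomposition.inversion {d : ℕ} {W : Fin (d + 1) → Submodule F V}
    (h : IsDecomposition W) : IsDecomposition (inversion W) := by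
  refine ⟨?_, fun i => h.2 _⟩
  rw [DirectSum.isInternal_submodule_iff_iSupIndep_and_iSup_eq_top]
  refine ⟨h.1.submodule_iSupIndep.comp Fin.rev_injective, ?_⟩
  rw [← h.iSup_eq_top]
  exact Fin.revPerm.surjective.iSup_comp (g := W)

theorem inversion_inversion {d : ℕ} (W : Fin (d + 1) → Submodule F V) :
    _root_.inversion (_root_.inversion W) = W := by
  funext i; simp [_root_.inversion]

theorem ActsOn.of_iSup_eq_top {d : ℕ} {W : Fin (d + 1) → Submodule F V} {M : End F V}
    {κ : ℕ → F} (hW : ⨆ j, W j = ⊤) (hM : ∀ i, ∀ w ∈ W i, M w = κ i • w) :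
    ActsOn (levelFlag W) M κ := by
  intro i v hv
  by_cases hi : d < i
  · rw [levelFlag_of_lt W hi, hW]; trivial
  have : levelFlag W (i + 1) ≤ (levelFlag W i).comap (M - κ i • (1 : End F V)) := by
    refine iSup₂_le fun j hj w hw => ?_
    simp only [Submodule.mem_comap, LinearMap.sub_apply, LinearMap.smul_apply,
      Module.End.one_apply]
    rw [hM j w hw]
    rcases Nat.lt_succ_iff_lt_or_eq.1 hj with h | h
    · rw [← sub_smul]
      exact Submodule.smul_mem _ _ (le_levelFlag W h hw)
    · rw [h, sub_self]; exact Submodule.zero_mem _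
  simpa using this hv

theorem exists_map_of_isInternal {d : ℕ} {W : Fin (d + 1) → Submodule F V}
    (hW : DirectSum.IsInternal W) (κ : Fin (d + 1) → F) :
    ∃ M : End F V, ∀ i, ∀ w ∈ W i, M w = κ i • w := by
  let e := LinearEquiv.ofBijective (DirectSum.coeLinearMap W) hW
  refine ⟨(DirectSum.toModule F (Fin (d + 1)) V fun i => κ i • (W i).subtype) ∘ₗ
    e.symm.toLinearMap, fun i w hw => ?_⟩
  have : e.symm w = DirectSum.lof F (Fin (d + 1)) (fun i => W i) i ⟨w, hw⟩ := by
    rw [LinearEquiv.symm_apply_eq]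
    exact (DirectSum.coeLinearMap_lof W i ⟨w, hw⟩).symm
  simp [this, DirectSum.toModule_lof]

theorem map_ext_of_iSup_eq_top {ι : Type*} {W : ι → Submodule F V} (hW : ⨆ i, W i = ⊤)
    {M N : End F V} (h : ∀ i, ∀ w ∈ W i, M w = N w) : M = N := by
  have : (⊤ : Submodule F V) ≤ LinearMap.eqLocus M N := by
    rw [← hW]
    exact iSup_le fun i w hw => h i w hw
  ext v
  exact this (Submodule.mem_top : v ∈ ⊤)

/-- The intersections of two opposite flags. -/
def oppositeInf (d : ℕ) (E G : ℕ → Submodule F V) (i : Fin (d + 1)) : Submodule F V :=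
  E (i + 1) ⊓ G (d + 1 - i)

theorem inversion_oppositeInf (d : ℕ) (E G : ℕ → Submodule F V) :
    _root_.inversion (oppositeInf d E G) = oppositeInf d G E := by
  funext i
  simp only [_root_.inversion, oppositeInf, Fin.val_rev]
  rw [inf_comm, show d + 1 - (d + 1 - ((i : ℕ) + 1)) = i + 1 by omega,
    show d + 1 - ((i : ℕ) + 1) + 1 = d + 1 - i by omega]

/-- In a vanishing sum take the largest index `m` with a nonzero term. That term is minus a sum of
earlier ones, hence lies in `E m`, which meets `G (d + 1 - m)` trivially. -/
theorem iSupIndep_oppositeInf {d : ℕ} {E G : ℕ → Submodule F V} (hE : Monotone E)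
    (hd : ∀ n m, n + m ≤ d + 1 → Disjoint (E n) (G m)) : iSupIndep (oppositeInf d E G) := by
  classical
  rw [iSupIndep_iff_finsetSum_eq_zero_imp_eq_zero]
  intro s v hv h0
  by_contra! hne
  obtain ⟨i, hi⟩ : ∃ i, i ∈ s.filter (fun i => v i ≠ 0) := by
    obtain ⟨i, h1, h2⟩ := hne
    exact ⟨i, Finset.mem_filter.2 ⟨h1, h2⟩⟩
  obtain ⟨m, hm, hmax⟩ := (s.filter (fun i => v i ≠ 0)).exists_max_image id ⟨i, hi⟩
  rw [Finset.mem_filter] at hm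
  apply hm.2
  have h1 : v m ∈ E m := by
    rw [← Finset.add_sum_erase s v hm.1, add_eq_zero_iff_eq_neg] at h0
    rw [h0]
    refine (E m).neg_mem (Submodule.sum_mem _ fun j hj => ?_)
    rw [Finset.mem_erase] at hj
    by_cases hz : v j = 0
    · rw [hz]; exact zero_mem _
    · have h2 := hmax j (Finset.mem_filter.2 ⟨hj.2, hz⟩)
      have h3 : (j : ℕ) + 1 ≤ m := lt_of_le_of_ne h2 hj.1
      exact hE h3 (hv j hj.2).1
  exact Submodule.disjoint_def.1 (hd m (d + 1 - m) (by omega)) _ h1 (hv m hm.1).2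

/-- The intersections with index at least `n` lie in `G (d + 1 - n)`, which is disjoint from `E n`;
so a vector of `E n` has no part in them. -/
theorem levelFlag_oppositeInf {d : ℕ} {E G : ℕ → Submodule F V} (hE : Monotone E)
    (hG : Monotone G) (hd : ∀ n m, n + m ≤ d + 1 → Disjoint (E n) (G m))
    (ht : ⨆ i, oppositeInf d E G i = ⊤) {n : ℕ} (hn : n ≤ d + 1) :
    levelFlag (oppositeInf d E G) n = E n := by
  have hle : levelFlag (oppositeInf d E G) n ≤ E n :=
    iSup₂_le fun j hj => inf_le_left.trans (hE hj)
  refine le_antisymm hle fun v hv => ?_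
  have h1 : (⊤ : Submodule F V) ≤ levelFlag (oppositeInf d E G) n ⊔ G (d + 1 - n) := by
    rw [← ht]
    refine iSup_le fun j => ?_
    by_cases hj : (j : ℕ) < n
    · exact le_sup_of_le_left (le_levelFlag _ hj)
    · exact le_sup_of_le_right (inf_le_right.trans (hG (by omega)))
  obtain ⟨x, hx, y, hy, rfl⟩ := Submodule.mem_sup.1 (h1 (Submodule.mem_top : v ∈ ⊤))
  have hy' : y ∈ E n := ((E n).add_mem_iff_right (hle hx)).1 hv
  rw [Submodule.disjoint_def.1 (hd n (d + 1 - n) (by omega)) y hy' hy, add_zero]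
  exact hx

/-- Two opposite flags whose intersections span `V`: there is a map acting on the intersections
by prescribed scalars. -/
theorem exists_actsOn_of_opposite {d : ℕ} {E G : ℕ → Submodule F V} (hE : IsFlag d E)
    (hG : IsFlag d G) (hd : ∀ n m, n + m ≤ d + 1 → Disjoint (E n) (G m))
    (ht : ⨆ i, oppositeInf d E G i = ⊤) (κ l : ℕ → F) (hκ : ∀ i ≤ d, l i = κ (d - i)) :
    ∃ K : End F V, ActsOn E K κ ∧ ActsOn G K l := by
  obtain ⟨K, hK⟩ := exists_map_of_isInternal
    ((DirectSum.isInternal_submodule_iff_iSupIndep_and_iSup_eq_top _).2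
      ⟨iSupIndep_oppositeInf hE.mono hd, ht⟩) (fun i => κ i)
  have top_of : ∀ {E : ℕ → Submodule F V}, IsFlag d E → ∀ i, d < i → E i = ⊤ := fun h i hi =>
    top_le_iff.1 (h.top ▸ h.mono hi)
  refine ⟨K, fun i v hv => ?_, fun i v hv => ?_⟩
  · by_cases hi : d < i
    · rw [top_of hE i hi]; trivial
    rw [← levelFlag_oppositeInf hE.mono hG.mono hd ht (by omega)] at hv ⊢
    exact ActsOn.of_iSup_eq_top ht hK i v hv
  · by_cases hi : d < i
    · rw [top_of hG i hi]; trivial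
    -- Exchanging the flags reverses the sequence of intersections, so the second action follows by
    -- the same argument.
    have ht' : ⨆ i, oppositeInf d G E i = ⊤ := by
      rw [← inversion_oppositeInf, ← ht]
      exact Fin.revPerm.surjective.iSup_comp (g := oppositeInf d E G)
    have hd' : ∀ n m, n + m ≤ d + 1 → Disjoint (G n) (E m) := fun n m h =>
      (hd m n (by omega)).symm
    rw [← levelFlag_oppositeInf hG.mono hE.mono hd' ht' (by omega)] at hv ⊢
    refine ActsOn.of_iSup_eq_top ht' (κ := l) (fun j w hw => ?_) i v hv
    rw [← inversion_oppositeInf] at hw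
    rw [hK _ w hw, hκ j (by omega), Fin.val_rev, show d + 1 - ((j : ℕ) + 1) = d - j by omega]

end Flags

/-! ### The weights q^(d-2i) and decompositions joining two flags. -/

section Segments

variable {F V : Type*} [Field F] [AddCommGroup V] [Module F V]

/-- The scalar `q ^ (d - 2 i)`. -/
def wt (q : F) (d i : ℕ) : F := q ^ ((d : ℤ) - 2 * (i : ℤ))

theorem wt_ne_zero {q : F} (hq0 : q ≠ 0) (d i : ℕ) : wt q d i ≠ 0 := zpow_ne_zero _ hq0

theorem zpow_ne_one {q : F} (hq : ∀ n : ℕ, 0 < n → q ^ n ≠ 1) {n : ℤ}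
    (hn : n ≠ 0) : q ^ n ≠ 1 := by
  intro h
  rcases Int.natAbs_eq n with e | e
  · rw [e, zpow_natCast] at h
    exact hq _ (Int.natAbs_pos.2 hn) h
  · rw [e, zpow_neg, zpow_natCast, inv_eq_one] at h
    exact hq _ (Int.natAbs_pos.2 hn) h

theorem zpow_inj {q : F} (hq0 : q ≠ 0) (hq : ∀ n : ℕ, 0 < n → q ^ n ≠ 1) {m n : ℤ}
    (h : q ^ m = q ^ n) : m = n := by
  by_contra hne
  refine zpow_ne_one hq (sub_ne_zero.2 hne) ?_
  rw [zpow_sub₀ hq0, h, div_self (zpow_ne_zero _ hq0)]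

theorem wt_inj {q : F} (hq0 : q ≠ 0) (hq : ∀ n : ℕ, 0 < n → q ^ n ≠ 1) {d i j : ℕ}
    (h : wt q d i = wt q d j) : i = j := by
  have := zpow_inj hq0 hq h
  omega

theorem wt_succ {q : F} (hq0 : q ≠ 0) (d i : ℕ) : wt q d (i + 1) = (q ^ 2)⁻¹ * wt q d i := by
  rw [wt, wt, show ((d : ℤ) - 2 * ((i + 1 : ℕ) : ℤ)) = -2 + (d - 2 * i) by push_cast; ring,
    zpow_add₀ hq0, zpow_neg, zpow_ofNat]

theorem wt_sub (q : F) {d i : ℕ} (h : i ≤ d) : wt q d (d - i) = (wt q d i)⁻¹ := by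
  rw [wt, wt, ← zpow_neg]
  congr 1
  push_cast [h]
  ring

/-- `W` runs from the flag of `D₁` to the flag of `D₂`. -/
def Joins {d : ℕ} (D₁ D₂ W : Fin (d + 1) → Submodule F V) : Prop :=
  IsDecomposition W ∧ partialSum W = partialSum D₁ ∧ partialSum (inversion W) = partialSum D₂

/-- A map acting suitably on two flags is the map of a decomposition joining the flags. -/
theorem joins_eigenspace {q : F} (hq0 : q ≠ 0) (hq : ∀ n : ℕ, 0 < n → q ^ n ≠ 1) {d : ℕ}
    {D₁ D₂ : Fin (d + 1) → Submodule F V}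
    (h₁ : IsDecomposition D₁) (h₂ : IsDecomposition D₂) {M : End F V}
    (hM₁ : ActsOn (levelFlag D₁) M (wt q d))
    (hM₂ : ActsOn (levelFlag D₂) M (fun i => (wt q d i)⁻¹)) :
    Joins D₁ D₂ (fun i => M.eigenspace (wt q d i)) := by
  have e1 := fun n (hn : n ≤ d + 1) => hM₁.levelFlag_eigenspace h₁.isFlag
    (fun i _ j _ h => wt_inj hq0 hq h) hn
  have e2 := fun n (hn : n ≤ d + 1) => hM₂.levelFlag_eigenspace h₂.isFlag
    (fun i _ j _ h => wt_inj hq0 hq (inv_injective h)) hn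
  have hsup : ⨆ i : Fin (d + 1), M.eigenspace (wt q d i) = ⊤ := by
    rw [← h₁.isFlag.top, ← e1 _ le_rfl, levelFlag_of_lt _ (Nat.lt_succ_self d)]
  refine ⟨⟨?_, fun i hi => ?_⟩, ?_, ?_⟩
  · rw [DirectSum.isInternal_submodule_iff_iSupIndep_and_iSup_eq_top]
    exact ⟨M.eigenspaces_iSupIndep.comp fun i j h => Fin.ext (wt_inj hq0 hq h), hsup⟩
  · refine h₁.isFlag.strict i (by omega) ?_
    rw [← e1 _ (by omega), ← e1 _ (by omega)]
    refine iSup₂_le fun j hj => ?_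
    rcases Nat.lt_succ_iff_lt_or_eq.1 hj with h | h
    · exact le_levelFlag (fun i : Fin (d + 1) => M.eigenspace (wt q d i)) h
    · rw [Fin.ext h, hi]; exact bot_le
  · exact partialSum_eq_iff.2 e1
  -- Inverting a weight reverses its index, so the inverted eigenspace sequence is the one belonging
  -- to the inverse weights.
  · refine partialSum_eq_iff.2 fun n hn => ?_
    rw [← e2 n hn]
    congr 1
    funext i
    simp only [inversion]
    rw [← wt_sub q (Nat.le_of_lt_succ i.2), Fin.val_rev,
      show d + 1 - ((i : ℕ) + 1) = d - i by omega]

/-- On the intersections of two opposite flags the map acts as a scalar. -/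
theorem ActsOn.mem_eigenspace {d : ℕ} {E G : ℕ → Submodule F V} {M : End F V} {κ l : ℕ → F}
    (hE : ActsOn E M κ) (hG : ActsOn G M l) (hd : ∀ n m, n + m ≤ d + 1 → Disjoint (E n) (G m))
    (hκ : ∀ i ≤ d, l (d - i) = κ i) {i : ℕ} (hi : i ≤ d) {v : V} (h1 : v ∈ E (i + 1))
    (h2 : v ∈ G (d + 1 - i)) : M v = κ i • v := by
  rw [show d + 1 - i = d - i + 1 by omega] at h2
  have h3 := hG _ v h2
  rw [hκ i hi] at h3
  exact sub_eq_zero.1 (Submodule.disjoint_def.1 (hd i (d - i) (by omega)) _ (hE i v h1) h3)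

theorem Joins.disjoint {d : ℕ} {D₁ D₂ W : Fin (d + 1) → Submodule F V} (hW : Joins D₁ D₂ W)
    (n m : ℕ) (hnm : n + m ≤ d + 1) : Disjoint (levelFlag D₁ n) (levelFlag D₂ m) := by
  rw [← partialSum_eq_iff.1 hW.2.1 n (by omega), ← partialSum_eq_iff.1 hW.2.2 m (by omega)]
  exact hW.1.disjoint_levelFlag hnm

/-- The source of uniqueness of edges: the i-th component is recovered by intersecting its two
partial sums. -/
theorem Joins.eq_oppositeInf {d : ℕ} {D₁ D₂ W : Fin (d + 1) → Submodule F V}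
    (hW : Joins D₁ D₂ W) : W = oppositeInf d (levelFlag D₁) (levelFlag D₂) := by
  funext i
  have h1 := partialSum_eq_iff.1 hW.2.1
  have h2 := partialSum_eq_iff.1 hW.2.2
  simp only [oppositeInf]
  rw [← h1 _ (by omega), ← h2 _ (by omega)]
  apply le_antisymm
  · refine le_inf (le_levelFlag W (Nat.lt_succ_self _)) ?_
    have := le_levelFlag (inversion W) (j := i.rev) (n := d + 1 - i)
      (by simp only [Fin.val_rev]; omega)
    simpa [inversion] using this
  · intro v hv
    obtain ⟨hv1, hv2⟩ := hv
    have h3 : levelFlag W (i + 1) ≤ levelFlag W i ⊔ W i := by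
      refine iSup₂_le fun j hj => ?_
      rcases Nat.lt_succ_iff_lt_or_eq.1 hj with h | h
      · exact le_sup_of_le_left (le_levelFlag W h)
      · rw [Fin.ext h]; exact le_sup_right
    obtain ⟨x, hx, y, hy, rfl⟩ := Submodule.mem_sup.1 (h3 hv1)
    have h4 : W i ≤ levelFlag (inversion W) (d + 1 - i) := by
      have := le_levelFlag (inversion W) (j := i.rev) (n := d + 1 - i)
        (by simp only [Fin.val_rev]; omega)
      simpa [inversion] using this
    have h5 := (Submodule.add_mem_iff_left _ (h4 hy)).1 hv2
    rw [Submodule.disjoint_def.1 (hW.1.disjoint_levelFlag (n := i) (m := d + 1 - i) (by omega))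
      x hx h5, zero_add]
    exact hy

theorem Joins.iSup_oppositeInf {d : ℕ} {D₁ D₂ W : Fin (d + 1) → Submodule F V}
    (hW : Joins D₁ D₂ W) : ⨆ i, oppositeInf d (levelFlag D₁) (levelFlag D₂) i = ⊤ := by
  rw [← hW.eq_oppositeInf]; exact hW.1.iSup_eq_top

theorem eigenspace_isCorrespondingMap (q : F) (d : ℕ) (M : End F V) :
    IsCorrespondingMap q (fun i : Fin (d + 1) => M.eigenspace (wt q d i)) M :=
  fun _ _ hw => Module.End.mem_eigenspace_iff.1 hw

end Segments

/-! ### The edges between middle and bottom vertices. -/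

section MidBot

variable {F V : Type*} [Field F] [AddCommGroup V] [Module F V]

/-- The eigenvalues `a q ^ (2 i - d) + a⁻¹ q ^ (d - 2 i)`. -/
def rho (q : F) (d : ℕ) (a : F) (i : ℕ) : F := a * (wt q d i)⁻¹ + a⁻¹ * wt q d i

theorem rho_sub (q : F) {d : ℕ} (a : F) {i : ℕ} (h : i ≤ d) :
    rho q d a (d - i) = rho q d a⁻¹ i := by
  rw [rho, rho, wt_sub q h, inv_inv, inv_inv, add_comm]

/-- The relation between `A` and a map `K` with `K` and `A` acting on two opposite flags. -/
theorem qComm_of_acts {q a : F} (hq0 : q ≠ 0) (ha : a ≠ 0) {d : ℕ}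
    {T R : ℕ → Submodule F V} {A K : End F V} (hT : Monotone T) (hR0 : R 0 = ⊥)
    (hd : ∀ n m, n + m ≤ d + 1 → Disjoint (T n) (R m))
    (ht : ⨆ i, oppositeInf d T R i = ⊤)
    (hKT : ActsOn T K (wt q d)) (hKR : ActsOn R K (fun i => (wt q d i)⁻¹))
    (hAT : ∀ n, ∀ v ∈ T n, A v ∈ T (n + 1)) (hAR : ActsOn R A (rho q d a)) :
    qComm q K A = (q - q⁻¹) • (a • (K * K) + a⁻¹ • (1 : End F V)) := by
  refine map_ext_of_iSup_eq_top ht fun i v hv => ?_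
  have hκ : ∀ i ≤ d, (fun i => (wt q d i)⁻¹) (d - i) = wt q d i := fun i hi => by
    simp only [wt_sub q hi, inv_inv]
  have hv1 : K v = wt q d i • v := hKT.mem_eigenspace hKR hd hκ (by omega) hv.1 hv.2
  -- The off-diagonal part of `A v` lies in the next intersection, so `K` scales it by q⁻² times the
  -- weight of `v`; its contributions to the q-commutator cancel.
  obtain ⟨u, hu⟩ : ∃ u, u = A v - rho q d a (d - i) • v := ⟨_, rfl⟩
  have hu1 : u ∈ T (i + 2) := hu ▸ (T (i + 2)).sub_mem (hAT _ _ hv.1)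
    ((T (i + 2)).smul_mem _ (hT (Nat.le_succ _) hv.1))
  have hu2 : u ∈ R (d - i) := by
    have := hv.2
    rw [show d + 1 - (i : ℕ) = d - i + 1 by omega] at this
    exact hu ▸ hAR _ v this
  have hu3 : K u = wt q d (i + 1) • u := by
    by_cases hi : (i : ℕ) = d
    · rw [hi, Nat.sub_self, hR0, Submodule.mem_bot] at hu2
      rw [hu2, map_zero, smul_zero]
    · exact hKT.mem_eigenspace hKR hd hκ (by omega) hu1
        (by rwa [show d + 1 - ((i : ℕ) + 1) = d - i by omega])
  have hA : A v = rho q d a (d - i) • v + u := by rw [hu]; abel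
  have hk := wt_ne_zero hq0 d i
  rw [wt_succ hq0] at hu3
  rw [rho_sub q a (by omega), rho] at hA
  generalize wt q d i = k at *
  simp only [qComm, LinearMap.sub_apply, LinearMap.smul_apply, Module.End.mul_apply, hv1, hA,
    map_add, map_smul, hu3, LinearMap.add_apply, Module.End.one_apply]
  match_scalars <;> field_simp <;> ring

theorem ActsOn.of_eigenspace {d : ℕ} {D : Fin (d + 1) → Submodule F V} (hD : IsDecomposition D)
    {A : End F V} {r : ℕ → F} (hA : ∀ i : Fin (d + 1), D i = A.eigenspace (r i)) :
    ActsOn (levelFlag D) A r :=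
  ActsOn.of_iSup_eq_top hD.iSup_eq_top fun i w hw => by
    rw [hA, Module.End.mem_eigenspace_iff] at hw
    exact hw

/-- `a A - a² K` is conjugate to `K⁻¹` by a map commuting with `A`. -/
theorem sub_eq_conj_inv {q a : F} (hq0 : q ≠ 0) (hq : ∀ n : ℕ, 0 < n → q ^ n ≠ 1) (ha : a ≠ 0)
    {d : ℕ} {D : Fin (d + 1) → Submodule F V} (hD : IsDecomposition D) {A K K' H H' : End F V}
    (hDA : ∀ i : Fin (d + 1), D i = A.eigenspace (rho q d a i))
    (hρ : ∀ i ≤ d, ∀ j ≤ d, rho q d a i = rho q d a j → i = j)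
    (hKR : ActsOn (levelFlag D) K (fun i => (wt q d i)⁻¹))
    (hrel : qComm q K A = (q - q⁻¹) • (a • (K * K) + a⁻¹ • (1 : End F V)))
    (hK1 : K * K' = 1) (hK2 : K' * K = 1) (hH1 : H * H' = 1) (hH2 : H' * H = 1)
    {τ : ℕ → F} (hτ0 : ∀ i, τ i ≠ 0)
    (hτ : ∀ i < d, τ (i + 1) = a ^ 2 * (wt q d (i + 1))⁻¹ * (wt q d i)⁻¹ * τ i)
    (hH : ∀ i : Fin (d + 1), ∀ v ∈ D i, H v = τ i • v) (hHA : H * A = A * H) :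
    a • A - a ^ 2 • K = H' * K' * H := by
  have hmono := levelFlag_mono D
  have h0 := levelFlag_zero D
  have hAR : ActsOn (levelFlag D) A (rho q d a) := ActsOn.of_eigenspace hD hDA
  have hHR : ActsOn (levelFlag D) H τ := ActsOn.of_iSup_eq_top hD.iSup_eq_top hH
  have hK' := hKR.inv h0 (fun i => inv_ne_zero (wt_ne_zero hq0 d i)) hmono hK2
  have hH' := hHR.inv h0 hτ0 hmono hH2
  have hH'A : H' * A = A * H' := by
    calc H' * A = H' * (A * H) * H' := by rw [mul_assoc, mul_assoc, hH1, mul_one]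
      _ = A * H' := by rw [← hHA, ← mul_assoc, hH2, one_mul]
  obtain ⟨Y, hY⟩ : ∃ Y, Y = a • A - a ^ 2 • K := ⟨_, rfl⟩
  obtain ⟨Z, hZ⟩ : ∃ Z, Z = H' * K' * H := ⟨_, rfl⟩
  have hYR : ActsOn (levelFlag D) Y (wt q d) := by
    rw [hY]
    refine ((hAR.smul a).sub (hKR.smul (a ^ 2))).congr fun i => ?_
    have := wt_ne_zero hq0 d i
    simp only [rho]
    field_simp
    ring
  have hZR : ActsOn (levelFlag D) Z (wt q d) := by
    rw [hZ]
    refine ((hH'.mul hK' hmono h0).mul hHR hmono h0).congr fun i => ?_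
    have := hτ0 i
    field_simp
  -- the common quadratic relation of `Y` and `Z`
  have hYA : qComm q A Y = (q - q⁻¹) • (a⁻¹ • (Y * Y) + a • (1 : End F V)) := by
    have e : q • (K * A) =
        q⁻¹ • (A * K) + (q - q⁻¹) • (a • (K * K) + a⁻¹ • (1 : End F V)) := by
      rw [← hrel, qComm]; abel
    have e' : K * A =
        q⁻¹ • (q⁻¹ • (A * K) + (q - q⁻¹) • (a • (K * K) + a⁻¹ • (1 : End F V))) := by
      rw [← e, smul_smul, inv_mul_cancel₀ hq0, one_smul]
    rw [hY]
    simp only [qComm, mul_sub, sub_mul, mul_smul_comm, smul_mul_assoc, e']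
    match_scalars <;> field_simp <;> ring
  have hZA : qComm q A Z = (q - q⁻¹) • (a⁻¹ • (Z * Z) + a • (1 : End F V)) := by
    have e1 : qComm q A K' = (q - q⁻¹) • (a⁻¹ • (K' * K') + a • (1 : End F V)) := by
      have := congrArg (fun X => K' * X * K') hrel
      simp only [qComm, mul_sub, sub_mul, mul_smul_comm, smul_mul_assoc, mul_add, add_mul,
        mul_one] at this
      rw [show K' * (K * A) * K' = A * K' by rw [← mul_assoc, hK2, one_mul],
        show K' * (A * K) * K' = K' * A by rw [mul_assoc, mul_assoc, hK1, mul_one],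
        show K' * (K * K) * K' = 1 by rw [← mul_assoc, hK2, one_mul, hK1]] at this
      rw [qComm, this]; module
    have := congrArg (fun X => H' * X * H) e1
    simp only [qComm, mul_sub, sub_mul, mul_smul_comm, smul_mul_assoc, mul_add, add_mul,
      mul_one] at this
    rw [show H' * (A * K') * H = A * Z by rw [hZ, ← mul_assoc, hH'A, mul_assoc, mul_assoc,
        mul_assoc],
      show H' * (K' * A) * H = Z * A by rw [hZ, mul_assoc, mul_assoc, mul_assoc, mul_assoc, hHA],
      show H' * (K' * K') * H = Z * Z by
        rw [hZ, show H' * K' * H * (H' * K' * H) = H' * K' * (H * H') * K' * H by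
          simp only [mul_assoc], hH1, mul_one]; simp only [mul_assoc],
      hH2] at this
    rw [qComm, this]
  obtain ⟨N, hN⟩ : ∃ N, N = Y - Z := ⟨_, rfl⟩
  -- Since Y² - Z² = YN + NZ, subtracting the two quadratic relations leaves one in which every term
  -- contains `N` once.
  have hNA : qComm q A N = ((q - q⁻¹) * a⁻¹) • (Y * N + N * Z) := by
    have : qComm q A N = qComm q A Y - qComm q A Z := by
      rw [hN]
      simp only [qComm, mul_sub, sub_mul, smul_sub]
      abel
    rw [this, hYA, hZA, hN]
    simp only [mul_sub, sub_mul]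
    module
  -- `N` lowers the flag by two steps
  have hbase : ∀ n, ∀ v ∈ levelFlag D (n + 2), N v ∈ levelFlag D n := by
    intro n
    have : levelFlag D (n + 2) ≤ (levelFlag D n).comap N := by
      refine iSup₂_le fun p hp v hv => ?_
      have hAv : A v = rho q d a p • v := by
        rw [hDA, Module.End.mem_eigenspace_iff] at hv; exact hv
      have hHv := hH p v hv
      obtain ⟨w, hw⟩ : ∃ w, w = K v - (wt q d p)⁻¹ • v := ⟨_, rfl⟩
      have hwR : w ∈ levelFlag D p := hw ▸ hKR p v (le_levelFlag D (Nat.lt_succ_self _) hv)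
      have hKv : K v = (wt q d p)⁻¹ • v + w := by rw [hw]; abel
      have hYv : Y v = wt q d p • v - a ^ 2 • w := by
        have := wt_ne_zero hq0 d p
        rw [hY]
        simp only [LinearMap.sub_apply, LinearMap.smul_apply, hAv, hKv, rho]
        match_scalars <;> field_simp
        ring
      have hNv : N v = (H' * K') ((wt q d p * τ p) • w - a ^ 2 • (K * H) w) := by
        have e : Y v = (H' * K') ((K * H) (Y v)) := by
          rw [← Module.End.mul_apply, show H' * K' * (K * H) = H' * (K' * K) * H by
            simp only [mul_assoc], hK2, mul_one, hH2, Module.End.one_apply]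
        have e2 : (K * H) (Y v) - H v = (wt q d p * τ p) • w - a ^ 2 • (K * H) w := by
          have := wt_ne_zero hq0 d p
          rw [hYv]
          simp only [map_sub, map_smul, Module.End.mul_apply, hHv, hKv]
          match_scalars <;> field_simp
          ring
        rw [← e2, map_sub, ← e, hN, hZ, LinearMap.sub_apply]
        rfl
      rw [Submodule.mem_comap]
      obtain ⟨p, hpd⟩ := p
      simp only at *
      cases p with
      | zero =>
        rw [h0, Submodule.mem_bot] at hwR
        rw [hNv, hwR]
        simp
      | succ m =>
        -- `K * H` acts on the quotient of `w` as (wt m)⁻¹ τ m. The recursion for `τ` makes a² times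
        -- this equal to wt (m+1) τ (m+1), so the bracket in `hNv` drops one level further.
        have h1 := (hKR.mul hHR hmono h0) m w hwR
        have h2 := (levelFlag D m).smul_mem (-a ^ 2) h1
        rw [hNv, hτ m (by omega)]
        refine hmono (by omega : m ≤ n) ((hH'.mul hK' hmono h0).map_mem hmono h0 ?_)
        convert h2 using 1
        have := wt_ne_zero hq0 d (m + 1)
        match_scalars <;> field_simp
    exact this
  have htop : ∀ i, d < i → levelFlag D i = ⊤ := fun i hi => by
    rw [levelFlag_of_lt D hi, hD.iSup_eq_top]
  -- Bootstrap: if `N` lowers the flag by `k + 2` steps, comparing both sides of `hNA` on one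
  -- quotient gives a scalar multiple of `N v` in the next lower level. The scalar is shown to be
  -- nonzero.
  have hstep : ∀ k, ∀ n, ∀ v ∈ levelFlag D (n + (k + 2)), N v ∈ levelFlag D n := by
    intro k
    induction k with
    | zero => exact hbase
    | succ k ih =>
      intro n v hv
      obtain ⟨p, hp⟩ : ∃ p, p = n + (k + 2) := ⟨_, rfl⟩
      by_cases hpd : d < p
      · exact ih n v (by rw [← hp, htop p hpd]; trivial)
      rw [← add_assoc n, show n + (k + 1) + 2 = p + 1 by omega] at hv
      have hNv : N v ∈ levelFlag D (n + 1) :=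
        ih (n + 1) v (by rwa [show n + 1 + (k + 2) = p + 1 by omega])
      have ihp : ∀ w ∈ levelFlag D p, N w ∈ levelFlag D n := by rw [hp]; exact ih n
      have h1 := ihp _ (hAR p v hv)
      have h2 := hAR n _ hNv
      have h3 := hYR n _ hNv
      have h4 := ihp _ (hZR p v hv)
      have h5 := congrArg (fun X => X v) hNA
      simp only [qComm, LinearMap.sub_apply, LinearMap.smul_apply, LinearMap.add_apply,
        Module.End.mul_apply] at h5
      rw [map_sub, map_smul] at h1 h4
      have hc : (q * rho q d a n - q⁻¹ * rho q d a p -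
          (q - q⁻¹) * a⁻¹ * (wt q d n + wt q d p)) • N v ∈ levelFlag D n := by
        have h6 := (levelFlag D n).add_mem
          ((levelFlag D n).sub_mem ((levelFlag D n).smul_mem (-q) h2)
            ((levelFlag D n).smul_mem (-q⁻¹) h1))
          ((levelFlag D n).smul_mem ((q - q⁻¹) * a⁻¹) ((levelFlag D n).add_mem h3 h4))
        convert h6 using 1
        have h7 : q • A (N v) = q⁻¹ • N (A v) + ((q - q⁻¹) * a⁻¹) • (Y (N v) + N (Z v)) := by
          rw [← h5]; abel
        rw [smul_sub (-q), neg_smul q (A (N v)), h7]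
        module
      refine (Submodule.smul_mem_iff _ ?_).1 hc
      have hwp : wt q d p = (q ^ (2 * (k + 2)))⁻¹ * wt q d n := by
        rw [hp]
        clear * - hq0
        induction k + 2 with
        | zero => simp
        | succ j ihj => rw [← add_assoc, wt_succ hq0, ihj, mul_add, pow_add, mul_inv]; ring
      have hne : rho q d a n ≠ rho q d a p := fun e => by
        have := hρ n (by omega) p (by omega) e
        omega
      have hwn := wt_ne_zero hq0 d n
      have hQ : q ^ (2 * k + 2) ≠ 1 := hq _ (by omega)
      have hq2 : q ^ (2 * (k + 2)) = q ^ 2 * q ^ (2 * k + 2) := by ring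
      rw [hq2] at hwp
      generalize q ^ (2 * k + 2) = Q at *
      intro h0
      have hQ0 : Q ≠ 0 := by
        rintro rfl
        rw [mul_zero, inv_zero, zero_mul] at hwp
        exact wt_ne_zero hq0 d p hwp
      rw [rho, rho, hwp] at hne h0
      generalize wt q d n = k0 at *
      -- The first factor is nonzero as q is not a root of unity; vanishing of the second would make
      -- the `n`-th and `p`-th eigenvalues of `A` equal.
      have hfac : (1 - Q) * (a ^ 2 * q ^ 2 * Q - k0 ^ 2) = 0 := by
        field_simp at h0
        refine mul_left_cancel₀ (pow_ne_zero 2 hq0) ?_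
        linear_combination h0
      rcases mul_eq_zero.1 hfac with h | h
      · exact hQ (sub_eq_zero.1 h).symm
      · apply hne
        field_simp
        linear_combination (1 - q ^ 2 * Q) * h
  rw [← hY, ← hZ, ← sub_eq_zero, ← hN]
  ext v
  have := hstep d 0 v (by rw [htop _ (by omega)]; trivial)
  rwa [h0, Submodule.mem_bot] at this

end MidBot

/-! ### The map M, the vertical edges and the equitable triples. -/

section Triples

variable {F V : Type*} [Field F] [AddCommGroup V] [Module F V]

/-- If `M = (a K - a⁻¹ B) / (a - a⁻¹)` acts on two opposite flags, then it satisfies quadratic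
relations with `K` and with `a A - a² K`. -/
theorem qComm_eq_sq {q a : F} (hq0 : q ≠ 0) (hq : ∀ n : ℕ, 0 < n → q ^ n ≠ 1) (ha : a ≠ 0)
    (haa : a - a⁻¹ ≠ 0) {d : ℕ} {D₁ D₂ : Fin (d + 1) → Submodule F V}
    (h₁ : IsDecomposition D₁) (h₂ : IsDecomposition D₂) {A K B M : End F V}
    (hM : M = (a - a⁻¹)⁻¹ • (a • K - a⁻¹ • B))
    (hK : ActsOn (levelFlag D₁) K (wt q d))
    (hX : ActsOn (levelFlag D₂) (a • A - a ^ 2 • K) (fun i => (wt q d i)⁻¹))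
    (hM1 : ActsOn (levelFlag D₁) M (wt q d))
    (hM2 : ActsOn (levelFlag D₂) M (fun i => (wt q d i)⁻¹))
    (hKA : qComm q K A = (q - q⁻¹) • (a • (K * K) + a⁻¹ • (1 : End F V)))
    (hBA : qComm q B A = (q - q⁻¹) • (a⁻¹ • (B * B) + a • (1 : End F V))) :
    qComm q K M = (q - q⁻¹) • (M * M) ∧
      qComm q M (a • A - a ^ 2 • K) = (q - q⁻¹) • (M * M) := by
  obtain ⟨X, hXdef⟩ : ∃ X, X = a • A - a ^ 2 • K := ⟨_, rfl⟩
  rw [← hXdef] at hX ⊢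
  obtain ⟨P, hP⟩ : ∃ P, P = qComm q K M - (q - q⁻¹) • (M * M) := ⟨_, rfl⟩
  obtain ⟨P', hP'⟩ : ∃ P', P' = qComm q M X - (q - q⁻¹) • (M * M) := ⟨_, rfl⟩
  have hm1 := levelFlag_mono D₁
  have hm2 := levelFlag_mono D₂
  have z1 := levelFlag_zero D₁
  have z2 := levelFlag_zero D₂
  -- Solving the definition of `M` for `B` and substituting in `hBA` expresses `M * A` through `A *
  -- M` and products of `K` and `M`; the two defects then become proportional.
  have hPP : P' = a ^ 2 • P := by
    have hB : B = a ^ 2 • K - (a ^ 2 - 1) • M := by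
      have haa' : a ^ 2 - 1 ≠ 0 := by
        intro h
        apply haa
        field_simp
        rwa [mul_zero]
      rw [hM]
      match_scalars <;> field_simp
      ring
    rw [hB] at hBA
    have e : (q * (a ^ 2 - 1)) • (M * A) =
        (q⁻¹ * (a ^ 2 - 1)) • (A * M) + a ^ 2 • qComm q K A - (q - q⁻¹) •
          (a⁻¹ • ((a ^ 2 • K - (a ^ 2 - 1) • M) * (a ^ 2 • K - (a ^ 2 - 1) • M)) +
            a • (1 : End F V)) := by
      rw [← hBA]
      simp only [qComm, mul_sub, sub_mul, mul_smul_comm, smul_mul_assoc]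
      module
    rw [hKA] at e
    have haa' : a ^ 2 - 1 ≠ 0 := by
      intro h
      apply haa
      field_simp
      rwa [mul_zero]
    have e' : M * A = (q * (a ^ 2 - 1))⁻¹ • ((q * (a ^ 2 - 1)) • (M * A)) := by
      rw [smul_smul, inv_mul_cancel₀ (mul_ne_zero hq0 haa'), one_smul]
    rw [e] at e'
    rw [hP', hP, hXdef]
    simp only [qComm, mul_sub, sub_mul, mul_smul_comm, smul_mul_assoc, e']
    match_scalars <;> field_simp <;> ring
  have a1 : ActsOn (levelFlag D₁) P (fun _ => 0) := by
    rw [hP, qComm]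
    refine ((((hK.mul hM1 hm1 z1).smul q).sub ((hM1.mul hK hm1 z1).smul q⁻¹)).sub
      ((hM1.mul hM1 hm1 z1).smul (q - q⁻¹))).congr fun i => ?_
    ring
  have a2 : ActsOn (levelFlag D₂) P' (fun _ => 0) := by
    rw [hP', qComm]
    refine ((((hM2.mul hX hm2 z2).smul q).sub ((hX.mul hM2 hm2 z2).smul q⁻¹)).sub
      ((hM2.mul hM2 hm2 z2).smul (q - q⁻¹))).congr fun i => ?_
    ring
  have hJ := joins_eigenspace hq0 hq h₁ h₂ hM1 hM2
  -- `P` lowers the first flag and, being proportional to `P'`, the second one too; so it maps each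
  -- intersection into `E i ⊓ G (d - i)`, which is zero.
  have hP0 : P = 0 := by
    refine map_ext_of_iSup_eq_top hJ.iSup_oppositeInf fun i v hv => ?_
    have h3 := a1 i v hv.1
    have hv2 := hv.2
    rw [show d + 1 - (i : ℕ) = d - i + 1 by omega] at hv2
    have h4 := a2 _ v hv2
    rw [zero_smul, sub_zero] at h3 h4
    rw [hPP, LinearMap.smul_apply, Submodule.smul_mem_iff _ (pow_ne_zero 2 ha)] at h4
    rw [LinearMap.zero_apply]
    exact Submodule.disjoint_def.1 (hJ.disjoint i (d - i) (by omega)) _ h3 h4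
  rw [hP0, smul_zero] at hPP
  exact ⟨sub_eq_zero.1 (hP ▸ hP0), sub_eq_zero.1 (hP' ▸ hPP)⟩

theorem sub_inv_ne_zero {q : F} (hq0 : q ≠ 0) (hq : ∀ n : ℕ, 0 < n → q ^ n ≠ 1) :
    q - q⁻¹ ≠ 0 := by
  intro h
  refine hq 2 (by norm_num) ?_
  field_simp at h
  linear_combination h

/-- Multiplying the relations of `M` with `K` and with `a A - a² K` by `M⁻¹` on both sides gives two
of the q-Weyl relations; in the third the `K²` terms cancel. -/
theorem isEquitableTriple_of_qComm {q a : F} (hq0 : q ≠ 0) (hq : ∀ n : ℕ, 0 < n → q ^ n ≠ 1)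
    (ha : a ≠ 0) {A K M : End F V} (hX : IsUnit (a • A - a ^ 2 • K)) (hM : IsUnit M)
    (hK : IsUnit K)
    (hKA : qComm q K A = (q - q⁻¹) • (a • (K * K) + a⁻¹ • (1 : End F V)))
    (hKM : qComm q K M = (q - q⁻¹) • (M * M))
    (hMX : qComm q M (a • A - a ^ 2 • K) = (q - q⁻¹) • (M * M)) :
    IsEquitableTriple q (a • A - a ^ 2 • K) (Ring.inverse M) K := by
  have hqq := sub_inv_ne_zero hq0 hq
  have h1 : Ring.inverse M * M = 1 := Ring.inverse_mul_cancel M hM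
  have h2 : M * Ring.inverse M = 1 := Ring.mul_inverse_cancel M hM
  have key : ∀ X Y : End F V, qComm q X Y = (q - q⁻¹) • (1 : End F V) → QWeyl q X Y := by
    intro X Y h
    rw [QWeyl, h, smul_smul, inv_mul_cancel₀ hqq, one_smul]
  refine ⟨hX, ?_, hK, key _ _ ?_, key _ _ ?_, key _ _ ?_⟩
  · exact ⟨⟨_, M, h1, h2⟩, rfl⟩
  · generalize a • A - a ^ 2 • K = X at *
    generalize Ring.inverse M = N at *
    have := congrArg (fun Y => N * Y * N) hMX
    simp only [qComm, mul_sub, sub_mul, mul_smul_comm, smul_mul_assoc] at this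
    rw [show N * (M * X) * N = X * N by rw [← mul_assoc, h1, one_mul],
      show N * (X * M) * N = N * X by rw [mul_assoc, mul_assoc, h2, mul_one],
      show N * (M * M) * N = 1 by rw [← mul_assoc, h1, one_mul, h2]] at this
    rw [qComm, this]
  · generalize Ring.inverse M = N at *
    have := congrArg (fun Y => N * Y * N) hKM
    simp only [qComm, mul_sub, sub_mul, mul_smul_comm, smul_mul_assoc] at this
    rw [show N * (M * K) * N = K * N by rw [← mul_assoc, h1, one_mul],
      show N * (K * M) * N = N * K by rw [mul_assoc, mul_assoc, h2, mul_one],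
      show N * (M * M) * N = 1 by rw [← mul_assoc, h1, one_mul, h2]] at this
    rw [qComm, this]
  · have : qComm q K (a • A - a ^ 2 • K) = a • qComm q K A - (a ^ 2 * (q - q⁻¹)) • (K * K) := by
      simp only [qComm, mul_sub, sub_mul, mul_smul_comm, smul_mul_assoc]
      module
    rw [this, hKA]
    match_scalars <;> field_simp
    ring

/-- The maps on the edges of the diagram meeting one of the two vertices on top. -/
theorem exists_edge_maps [FiniteDimensional F V] {q a : F} (hq0 : q ≠ 0)
    (hq : ∀ n : ℕ, 0 < n → q ^ n ≠ 1) (ha : a ≠ 0) (haa : a - a⁻¹ ≠ 0)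
    {d : ℕ} {T R L S : Fin (d + 1) → Submodule F V}
    (hT : IsDecomposition T) (hR : IsDecomposition R) (hL : IsDecomposition L)
    (hS : IsDecomposition S) {A H H' : End F V}
    (hRA : ∀ i : Fin (d + 1), R i = A.eigenspace (rho q d a i))
    (hLA : ∀ i : Fin (d + 1), L i = A.eigenspace (rho q d a⁻¹ i))
    (hρ : ∀ i ≤ d, ∀ j ≤ d, rho q d a i = rho q d a j → i = j)
    (hAT : ∀ n, ∀ v ∈ levelFlag T n, A v ∈ levelFlag T (n + 1))
    (hTR : ∀ n m, n + m ≤ d + 1 → Disjoint (levelFlag T n) (levelFlag R m))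
    (hTR' : ⨆ i, oppositeInf d (levelFlag T) (levelFlag R) i = ⊤)
    (hTL : ∀ n m, n + m ≤ d + 1 → Disjoint (levelFlag T n) (levelFlag L m))
    (hTL' : ⨆ i, oppositeInf d (levelFlag T) (levelFlag L) i = ⊤)
    (hH1 : H * H' = 1) (hH2 : H' * H = 1) (hHA : H * A = A * H)
    {τ : ℕ → F} (hτ0 : ∀ i, τ i ≠ 0)
    (hτ : ∀ i < d, τ (i + 1) = a ^ 2 * (wt q d (i + 1))⁻¹ * (wt q d i)⁻¹ * τ i)
    (hH : ∀ i : Fin (d + 1), ∀ v ∈ R i, H v = τ i • v)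
    (hLR : L = inversion R)
    (hST : ∀ n, levelFlag S n = (levelFlag T n).map H') :
    ∃ K B M : End F V, M = (a - a⁻¹)⁻¹ • (a • K - a⁻¹ • B) ∧ IsUnit M ∧
      (ActsOn (levelFlag T) K (wt q d) ∧ ActsOn (levelFlag R) K (fun i => (wt q d i)⁻¹)) ∧
      (ActsOn (levelFlag T) B (wt q d) ∧ ActsOn (levelFlag L) B (fun i => (wt q d i)⁻¹)) ∧
      (ActsOn (levelFlag R) (a • A - a ^ 2 • K) (wt q d) ∧
        ActsOn (levelFlag S) (a • A - a ^ 2 • K) (fun i => (wt q d i)⁻¹)) ∧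
      (ActsOn (levelFlag L) (a⁻¹ • A - (a ^ 2)⁻¹ • B) (wt q d) ∧
        ActsOn (levelFlag S) (a⁻¹ • A - (a ^ 2)⁻¹ • B) (fun i => (wt q d i)⁻¹)) ∧
      (ActsOn (levelFlag S) (Ring.inverse M) (wt q d) ∧
        ActsOn (levelFlag T) (Ring.inverse M) (fun i => (wt q d i)⁻¹)) ∧
      IsEquitableTriple q (a • A - a ^ 2 • K) (Ring.inverse M) K ∧
      IsEquitableTriple q (a⁻¹ • A - (a ^ 2)⁻¹ • B) (Ring.inverse M) B := by
  have hw := wt_ne_zero hq0 d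
  have hw' : ∀ i, (wt q d i)⁻¹ ≠ 0 := fun i => inv_ne_zero (hw i)
  have ha' := inv_ne_zero ha
  -- the half of the argument concerning one of the two vertices in the middle
  have half : ∀ (b : F) (D : Fin (d + 1) → Submodule F V) (σ : ℕ → F), b ≠ 0 →
      IsDecomposition D → (∀ i : Fin (d + 1), D i = A.eigenspace (rho q d b i)) →
      (∀ i ≤ d, ∀ j ≤ d, rho q d b i = rho q d b j → i = j) →
      (∀ n m, n + m ≤ d + 1 → Disjoint (levelFlag T n) (levelFlag D m)) →
      (⨆ i, oppositeInf d (levelFlag T) (levelFlag D) i = ⊤) →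
      (∀ i, σ i ≠ 0) →
      (∀ i < d, σ (i + 1) = b ^ 2 * (wt q d (i + 1))⁻¹ * (wt q d i)⁻¹ * σ i) →
      (∀ i : Fin (d + 1), ∀ v ∈ D i, H v = σ i • v) →
      ∃ K : End F V, ActsOn (levelFlag T) K (wt q d) ∧
        ActsOn (levelFlag D) K (fun i => (wt q d i)⁻¹) ∧
        ActsOn (levelFlag D) (b • A - b ^ 2 • K) (wt q d) ∧
        ActsOn (levelFlag S) (b • A - b ^ 2 • K) (fun i => (wt q d i)⁻¹) ∧
        qComm q K A = (q - q⁻¹) • (b • (K * K) + b⁻¹ • (1 : End F V)) := by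
    intro b D σ hb hD hDA hρ' hTD hTD' hσ0 hσ hHD
    obtain ⟨K, hK1, hK2⟩ := exists_actsOn_of_opposite hT.isFlag hD.isFlag hTD hTD' (wt q d)
      (fun i => (wt q d i)⁻¹) (fun i hi => (wt_sub q hi).symm)
    have hAD : ActsOn (levelFlag D) A (rho q d b) := ActsOn.of_eigenspace hD hDA
    have hrel := qComm_of_acts hq0 hb (levelFlag_mono T) (levelFlag_zero D) hTD hTD' hK1 hK2
      hAT hAD
    obtain ⟨⟨K0, K', hKK1, hKK2⟩, rfl⟩ := hK1.isUnit (levelFlag_zero T) hT.isFlag.top hw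
    simp only at *
    have hX := sub_eq_conj_inv hq0 hq hb hD hDA hρ' hK2 hrel hKK1 hKK2 hH1 hH2 hσ0 hσ hHD hHA
    refine ⟨K0, hK1, hK2, ?_, ?_, hrel⟩
    · refine ((hAD.smul b).sub (hK2.smul (b ^ 2))).congr fun i => ?_
      have := hw i
      simp only [rho]
      field_simp
      ring
    · rw [hX, funext hST]
      exact (hK1.inv (levelFlag_zero T) hw (levelFlag_mono T) hKK2).conj hH1
  obtain ⟨K, hKT, hKR, hXR, hXS, hKA⟩ := half a R τ ha hR hRA hρ hTR hTR' hτ0 hτ hH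
  -- The other middle vertex is the same situation with `a` inverted and the eigenspaces, hence also
  -- the scalars of `H`, in reverse order.
  obtain ⟨B, hBT, hBL, hXL', hXS', hBA⟩ := half a⁻¹ L (fun i => τ (d - i)) ha' hL hLA (by
    intro i hi j hj h
    rw [← rho_sub q a hi, ← rho_sub q a hj] at h
    have := hρ _ (by omega) _ (by omega) h
    omega) hTL hTL' (fun i => hτ0 _) (by
    intro i hi
    have h1 := hτ (d - (i + 1)) (by omega)
    have h2 : d - (i + 1) + 1 = d - i := by omega
    have h3 := hw i
    have h4 := hw (i + 1)
    rw [h2, wt_sub q hi, wt_sub q hi.le, inv_inv, inv_inv] at h1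
    simp only [h1]
    field_simp) (by
    intro i v hv
    rw [hLR] at hv
    rw [hH _ v hv, Fin.val_rev, show d + 1 - ((i : ℕ) + 1) = d - i by omega])
  rw [inv_inv] at hBA
  rw [inv_pow] at hXL' hXS'
  obtain ⟨M, hM⟩ : ∃ M, M = (a - a⁻¹)⁻¹ • (a • K - a⁻¹ • B) := ⟨_, rfl⟩
  have hM1 : ActsOn (levelFlag T) M (wt q d) := by
    rw [hM]
    refine (((hKT.smul a).sub (hBT.smul a⁻¹)).smul (a - a⁻¹)⁻¹).congr fun i => ?_
    rw [← sub_mul, ← mul_assoc, inv_mul_cancel₀ haa, one_mul]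
  have hM2 : ActsOn (levelFlag S) M (fun i => (wt q d i)⁻¹) := by
    -- `A` cancels here, which exhibits `M` as a combination of the two maps ending at the bottom
    -- flag.
    have e : M = (a - a⁻¹)⁻¹ • (a • (a⁻¹ • A - (a ^ 2)⁻¹ • B) - a⁻¹ • (a • A - a ^ 2 • K)) := by
      rw [hM]
      congr 1
      match_scalars <;> field_simp
      ring
    rw [e]
    refine (((hXS'.smul a).sub (hXS.smul a⁻¹)).smul (a - a⁻¹)⁻¹).congr fun i => ?_
    rw [← sub_mul, ← mul_assoc, inv_mul_cancel₀ haa, one_mul]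
  have uM := hM1.isUnit (levelFlag_zero T) hT.isFlag.top hw
  have uK := hKT.isUnit (levelFlag_zero T) hT.isFlag.top hw
  have uB := hBT.isUnit (levelFlag_zero T) hT.isFlag.top hw
  have uX := hXR.isUnit (levelFlag_zero R) hR.isFlag.top hw
  have uX' := hXL'.isUnit (levelFlag_zero L) hL.isFlag.top hw
  have r1 := qComm_eq_sq hq0 hq ha haa hT hS hM hKT hXS hM1 hM2 hKA hBA
  -- `M` is unchanged when (a, K) and (a⁻¹, B) are exchanged, so the second triple comes from the
  -- same lemma.
  have hM' : M = (a⁻¹ - a⁻¹⁻¹)⁻¹ • (a⁻¹ • B - a⁻¹⁻¹ • K) := by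
    rw [hM, inv_inv, ← neg_sub a a⁻¹, inv_neg, neg_smul, ← smul_neg, neg_sub]
  have haa' : a⁻¹ - a⁻¹⁻¹ ≠ 0 := by
    rw [inv_inv, ← neg_sub, neg_ne_zero]; exact haa
  rw [← inv_pow] at hXS' uX' hXL'
  have r2 := qComm_eq_sq hq0 hq ha' haa' hT hS hM' hBT hXS' hM1 hM2
    (by rw [inv_inv]; exact hBA) (by rw [inv_inv]; exact hKA)
  rw [← inv_pow]
  refine ⟨K, B, M, hM, uM, ⟨hKT, hKR⟩, ⟨hBT, hBL⟩, ⟨hXR, hXS⟩, ⟨hXL', hXS'⟩, ⟨?_, ?_⟩, ?_, ?_⟩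
  · exact (hM2.inv (levelFlag_zero S) hw' (levelFlag_mono S)
      (Ring.inverse_mul_cancel M uM)).congr fun i => inv_inv _
  · exact hM1.inv (levelFlag_zero T) hw (levelFlag_mono T) (Ring.inverse_mul_cancel M uM)
  · exact isEquitableTriple_of_qComm hq0 hq ha uX uM uK hKA r1.1 r1.2
  · exact isEquitableTriple_of_qComm hq0 hq ha' uX' uM uB (by rw [inv_inv]; exact hBA) r2.1 r2.2

end Triples

/-! ### Adjacent scalars and the closed form of the eigenvalues. -/

section Adjacency

variable {F : Type*} [Field F]

theorem Adjacent.symm {q x y : F} (h : Adjacent q x y) : Adjacent q y x :=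
  ⟨h.1.symm, by rw [← h.2]; ring⟩

/-- Vieta: `x` and `z` are the two roots of a monic quadratic with coefficients depending on `y`. -/
theorem Adjacent.add_eq {q x y z : F} (h : Adjacent q x y) (h' : Adjacent q z y) (hne : x ≠ z) :
    x + z = (q ^ 2 + (q ^ 2)⁻¹) * y := by
  have : (x - z) * (x + z - (q ^ 2 + (q ^ 2)⁻¹) * y) = 0 := by
    linear_combination h.2 - h'.2
  exact sub_eq_zero.1 ((mul_eq_zero.1 this).resolve_left (sub_ne_zero.2 hne))

/-- A sequence of distinct scalars with adjacent consecutive terms has a closed form. -/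
theorem exists_eq_rho {q : F} (hq0 : q ≠ 0) (hq : ∀ n : ℕ, 0 < n → q ^ n ≠ 1) {d : ℕ}
    (hd : 0 < d) {θ : Fin (d + 1) → F} (hinj : Function.Injective θ)
    (hadj : ∀ i : Fin d, Adjacent q (θ i.castSucc) (θ i.succ)) :
    ∃ a : F, a ≠ 0 ∧ ∀ i : Fin (d + 1), θ i = rho q d a⁻¹ i := by
  have hadj' : ∀ i (h : i < d), Adjacent q (θ ⟨i, by omega⟩) (θ ⟨i + 1, by omega⟩) :=
    fun i h => hadj ⟨i, h⟩
  have hq4 : q ^ 4 - 1 ≠ 0 := sub_ne_zero.2 (hq 4 (by norm_num))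
  have hw := wt_ne_zero hq0 d
  obtain ⟨x, hx⟩ : ∃ x, x = θ ⟨0, by omega⟩ := ⟨_, rfl⟩
  obtain ⟨y, hy⟩ : ∃ y, y = θ ⟨1, by omega⟩ := ⟨_, rfl⟩
  have h01 := (hadj' 0 hd).2
  simp only [zero_add] at h01
  rw [← hx, ← hy] at h01
  -- `α` and `x - α` solve x = α + β, y = α q⁻² + β q²; adjacency of `x` and `y` then says αβ = 1.
  obtain ⟨α, hα⟩ : ∃ α, α = (q ^ 4 * x - q ^ 2 * y) / (q ^ 4 - 1) := ⟨_, rfl⟩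
  have hy' : y = α * (q ^ 2)⁻¹ + (x - α) * q ^ 2 := by
    rw [hα]
    field_simp
    ring
  have h1 : α * (x - α) = 1 := by
    rw [hy'] at h01
    have e : (q ^ 4 - 1) ^ 2 * (1 - α * (x - α)) = 0 := by
      field_simp at h01
      linear_combination h01
    have := (mul_eq_zero.1 e).resolve_left (pow_ne_zero 2 hq4)
    exact (sub_eq_zero.1 this).symm
  have hα0 : α ≠ 0 := left_ne_zero_of_mul_eq_one h1
  have hβ : x - α = α⁻¹ := eq_inv_of_mul_eq_one_right h1
  refine ⟨α * (wt q d 0)⁻¹, mul_ne_zero hα0 (inv_ne_zero (hw 0)), ?_⟩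
  obtain ⟨a, ha⟩ : ∃ a, a = α * (wt q d 0)⁻¹ := ⟨_, rfl⟩
  have ha0 : a ≠ 0 := ha ▸ mul_ne_zero hα0 (inv_ne_zero (hw 0))
  have hαa : α = a * wt q d 0 := by rw [ha, mul_assoc, inv_mul_cancel₀ (hw 0), mul_one]
  rw [← ha]
  have key : ∀ i (h : i < d), θ ⟨i, by omega⟩ = rho q d a⁻¹ i ∧
      θ ⟨i + 1, by omega⟩ = rho q d a⁻¹ (i + 1) := by
    intro i
    induction i with
    | zero =>
      intro h
      have hw0 := hw 0
      simp only [zero_add]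
      rw [← hx, ← hy, rho, rho, inv_inv, ← zero_add 1, wt_succ hq0]
      constructor
      · rw [← sub_add_cancel x α, hβ, hαa, mul_inv]
      · rw [hy', hβ, hαa]
        field_simp
        ring
    | succ i ih =>
      intro h
      obtain ⟨h2, h3⟩ := ih (by omega)
      refine ⟨h3, ?_⟩
      have h4 := (hadj' i (by omega)).add_eq (hadj' (i + 1) h).symm (fun e => by
        have := Fin.val_eq_of_eq (hinj e)
        simp only at this
        omega)
      rw [h2, h3] at h4
      have hwi := hw i
      rw [eq_sub_of_add_eq' h4]
      simp only [rho, inv_inv, wt_succ hq0]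
      field_simp
      ring
  rintro ⟨i, hi⟩
  rcases Nat.lt_or_ge i d with h | h
  · exact (key i h).1
  · obtain ⟨e, rfl⟩ : ∃ e, d = e + 1 := ⟨d - 1, by omega⟩
    obtain rfl : i = e + 1 := by omega
    exact (key e (by omega)).2

/-- The adjacency polynomial splits into four factors. Two say that the indices differ by one. The
others say that, after shifting an index by one, the product of the weights is a², which makes two
eigenvalues equal; where no shift fits the range, both indices sit at the same end. -/
theorem rho_adjacent {q a : F} (hq0 : q ≠ 0) (hq : ∀ n : ℕ, 0 < n → q ^ n ≠ 1) (ha : a ≠ 0)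
    {d : ℕ} (hρ : ∀ i ≤ d, ∀ j ≤ d, rho q d a i = rho q d a j → i = j) {i j : ℕ} (hi : i ≤ d)
    (hj : j ≤ d) (h : Adjacent q (rho q d a j) (rho q d a i)) : j ≤ i + 1 ∧ i ≤ j + 1 := by
  have h2 := h.2
  have hwi := wt_ne_zero hq0 d i
  have hwj := wt_ne_zero hq0 d j
  have hfac : ((wt q d i * q ^ 2 - wt q d j) * (wt q d j * q ^ 2 - wt q d i)) *
      ((wt q d i * wt q d j - a ^ 2 * q ^ 2) * (wt q d i * wt q d j * q ^ 2 - a ^ 2)) = 0 := by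
    rw [rho, rho] at h2
    generalize wt q d i = k at *
    generalize wt q d j = m at *
    field_simp at h2
    linear_combination (-1) * h2
  have eq_of : ∀ {s t : ℕ}, s ≤ d → t ≤ d → wt q d s * wt q d t = a ^ 2 → s = t := by
    intro s t hs ht e
    refine hρ s hs t ht ?_
    have h3 := wt_ne_zero hq0 d s
    have h4 := wt_ne_zero hq0 d t
    rw [rho, rho]
    field_simp
    linear_combination (wt q d s - wt q d t) * e
  have hs : ∀ s, wt q d (s + 1) * q ^ 2 = wt q d s := fun s => by
    rw [wt_succ hq0]; field_simp
  have hq2 : q ^ 2 ≠ 0 := pow_ne_zero 2 hq0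
  rcases mul_eq_zero.1 hfac with h | h <;> rcases mul_eq_zero.1 h with h | h
  · have e : wt q d (j + 1) = wt q d i := by
      refine mul_right_cancel₀ hq2 ?_
      rw [hs]; linear_combination -h
    have := wt_inj hq0 hq e
    omega
  · have e : wt q d (i + 1) = wt q d j := by
      refine mul_right_cancel₀ hq2 ?_
      rw [hs]; linear_combination -h
    have := wt_inj hq0 hq e
    omega
  · rcases Nat.lt_or_ge i d with hid | hid
    · have := eq_of (s := i + 1) (t := j) (by omega) hj (by
        refine mul_right_cancel₀ hq2 ?_
        linear_combination h + hs i * wt q d j)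
      omega
    · rcases Nat.lt_or_ge j d with hjd | hjd
      · have := eq_of (s := j + 1) (t := i) (by omega) hi (by
          refine mul_right_cancel₀ hq2 ?_
          linear_combination h + hs j * wt q d i)
        omega
      · omega
  · rcases Nat.eq_zero_or_pos i with hi0 | hi0
    · rcases Nat.eq_zero_or_pos j with hj0 | hj0
      · omega
      · obtain ⟨s, rfl⟩ : ∃ s, j = s + 1 := ⟨j - 1, by omega⟩
        have := eq_of (s := s) (t := i) (by omega) hi (by
          linear_combination h - hs s * wt q d i)
        omega
    · obtain ⟨s, rfl⟩ : ∃ s, i = s + 1 := ⟨i - 1, by omega⟩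
      have := eq_of (s := s) (t := j) (by omega) hj (by
        linear_combination h - hs s * wt q d j)
      omega

end Adjacency

/-! ### Consequences of the q-Dolan/Grady relations: existence of standard orderings. -/

section OnsagerPair

variable {F V : Type*} [Field F] [AddCommGroup V] [Module F V]

/-- Two diagonalizable maps that satisfy the `q`-Dolan/Grady relations and act irreducibly on a
space of dimension at least two. -/
structure IsOnsagerPair (q : F) (A B : End F V) : Prop where
  rel₁ : ⁅A, qComm q⁻¹ A (qComm q A B)⁆ = (q ^ 2 - (q ^ 2)⁻¹) ^ 2 • ⁅B, A⁆
  rel₂ : ⁅B, qComm q⁻¹ B (qComm q B A)⁆ = (q ^ 2 - (q ^ 2)⁻¹) ^ 2 • ⁅A, B⁆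
  irreducible : ∀ W : Submodule F V, (∀ v ∈ W, A v ∈ W) → (∀ v ∈ W, B v ∈ W) → W = ⊥ ∨ W = ⊤
  diag₁ : IsDiagonalizable A
  diag₂ : IsDiagonalizable B
  two_le : 2 ≤ finrank F V

namespace IsOnsagerPair

theorem symm {q : F} {A B : End F V} (h : IsOnsagerPair q A B) : IsOnsagerPair q B A :=
  ⟨h.rel₂, h.rel₁, fun W h1 h2 => h.irreducible W h2 h1, h.diag₂, h.diag₁, h.two_le⟩

/-- On a μ-eigenvector the first relation becomes a cubic in `A` annihilating `B v`. Its roots are μ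
and the solutions of the adjacency equation. -/
theorem map_mem_adjacent {q : F} (hq0 : q ≠ 0) {A B : End F V} (h : IsOnsagerPair q A B) {μ : F}
    {v : V} (hv : v ∈ A.eigenspace μ) :
    B v ∈ ⨆ x : F, ⨆ _ : x = μ ∨ Adjacent q x μ, A.eigenspace x := by
  rw [Module.End.mem_eigenspace_iff] at hv
  obtain ⟨c, hc⟩ : ∃ c, c = q ^ 2 + 1 + (q ^ 2)⁻¹ := ⟨_, rfl⟩
  obtain ⟨k, hk⟩ : ∃ k, k = (q ^ 2 - (q ^ 2)⁻¹) ^ 2 := ⟨_, rfl⟩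
  obtain ⟨Q, hQ⟩ : ∃ Q : End F V, Q = A * A * A - (c * μ) • (A * A) +
      (c * μ ^ 2 + k) • A - (μ ^ 3 + k * μ) • 1 := ⟨_, rfl⟩
  have hQB : Q (B v) = 0 := by
    have h1 := congrArg (fun X => X v) h.rel₁
    rw [← hk] at h1
    simp only [qComm, Ring.lie_def, LinearMap.sub_apply, LinearMap.smul_apply,
      Module.End.mul_apply, hv, map_sub, map_smul] at h1
    rw [← sub_eq_zero] at h1
    rw [hQ, ← h1]
    simp only [LinearMap.sub_apply, LinearMap.add_apply, LinearMap.smul_apply,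
      Module.End.mul_apply, Module.End.one_apply]
    rw [hc]
    match_scalars <;> field_simp
    all_goals ring
  have hQE : ∀ x, ∀ w ∈ A.eigenspace x,
      Q w = ((x - μ) * (x ^ 2 - (q ^ 2 + (q ^ 2)⁻¹) * x * μ + μ ^ 2 + k)) • w := by
    intro x w hw
    rw [Module.End.mem_eigenspace_iff] at hw
    rw [hQ]
    simp only [LinearMap.sub_apply, LinearMap.add_apply, LinearMap.smul_apply,
      Module.End.mul_apply, Module.End.one_apply, hw, map_smul]
    rw [hc]
    match_scalars
    ring
  obtain ⟨f, hf, hsum⟩ := (Submodule.mem_iSup_iff_exists_finsupp A.eigenspace (B v)).1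
    (by rw [h.diag₁]; trivial)
  rw [Finsupp.sum] at hsum
  have h0 : ∑ x ∈ f.support,
      ((x - μ) * (x ^ 2 - (q ^ 2 + (q ^ 2)⁻¹) * x * μ + μ ^ 2 + k)) • f x = 0 := by
    rw [← hQB, ← hsum, map_sum]
    exact Finset.sum_congr rfl fun x _ => (hQE x _ (hf x)).symm
  have h1 := (iSupIndep_iff_finsetSum_eq_zero_imp_eq_zero _).1 A.eigenspaces_iSupIndep
    f.support _ (fun x _ => Submodule.smul_mem _ _ (hf x)) h0
  rw [← hsum]
  refine Submodule.sum_mem _ fun x hx => ?_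
  have h2 := (smul_eq_zero.1 (h1 x hx)).resolve_right (Finsupp.mem_support_iff.1 hx)
  refine Submodule.mem_iSup_of_mem x (Submodule.mem_iSup_of_mem ?_ (hf x))
  by_cases hxμ : x = μ
  · exact Or.inl hxμ
  · refine Or.inr ⟨hxμ, ?_⟩
    rw [← hk]
    exact (mul_eq_zero.1 h2).resolve_left (sub_ne_zero.2 hxμ)

theorem exists_hasEigenvalue {q : F} {A B : End F V} (h : IsOnsagerPair q A B) :
    ∃ μ, A.HasEigenvalue μ := by
  by_contra! hne
  have h1 : (⊤ : Submodule F V) = ⊥ := by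
    rw [← h.diag₁, iSup_eq_bot]
    intro μ
    by_contra h2
    exact hne μ h2
  have h2 := h.two_le
  rw [← finrank_top F V, h1, finrank_bot] at h2
  omega

/-- Take a longest chain of distinct, consecutively adjacent eigenvalues. No further eigenvalue is
adjacent to a member, so the sum of its eigenspaces is invariant and equals `V`. -/
theorem exists_isStandardOrdering [FiniteDimensional F V] {q : F} (hq0 : q ≠ 0) {A B : End F V}
    (h : IsOnsagerPair q A B) :
    ∃ (d : ℕ) (θ : Fin (d + 1) → F), IsStandardOrdering q A θ := by
  classical
  let P : ℕ → Prop := fun n => ∃ θ : Fin (n + 1) → F, Function.Injective θ ∧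
    (∀ i, A.HasEigenvalue (θ i)) ∧ ∀ i : Fin n, Adjacent q (θ i.castSucc) (θ i.succ)
  have hP0 : P 0 := by
    obtain ⟨μ, hμ⟩ := h.exists_hasEigenvalue
    exact ⟨fun _ => μ, fun i j _ => Subsingleton.elim (α := Fin 1) i j, fun _ => hμ,
      fun i => i.elim0⟩
  have hPle : ∀ n, P n → n ≤ finrank F V := by
    rintro n ⟨θ, hinj, heig, -⟩
    choose v hv using fun i => (heig i).exists_hasEigenvector
    have := (Module.End.eigenvectors_linearIndependent' A θ hinj v hv).fintype_card_le_finrank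
    rw [Fintype.card_fin] at this
    omega
  obtain ⟨d, hd⟩ : ∃ d, d = Nat.findGreatest P (finrank F V) := ⟨_, rfl⟩
  have hPd : P d := hd ▸ Nat.findGreatest_spec (Nat.zero_le _) hP0
  have hPd' : ¬ P (d + 1) := fun hp => by
    have := Nat.le_findGreatest (hPle _ hp) hp
    omega
  obtain ⟨θ, hinj, heig, hadj⟩ := hPd
  have hadj' : ∀ i (h : i < d), Adjacent q (θ ⟨i, by omega⟩) (θ ⟨i + 1, by omega⟩) :=
    fun i h => hadj ⟨i, h⟩
  have hclosed : ∀ x, A.HasEigenvalue x → ∀ i, Adjacent q x (θ i) → ∃ j, θ j = x := by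
    intro x hx i hxi
    by_contra! hne
    rcases Nat.eq_zero_or_pos i with hi | hi
    · apply hPd'
      refine ⟨Fin.cons x θ, Fin.cons_injective_iff.2 ⟨fun ⟨j, hj⟩ => hne j hj, hinj⟩, ?_, ?_⟩
      · intro j
        refine Fin.cases ?_ (fun j => ?_) j
        · exact hx
        · exact heig j
      · intro j
        refine Fin.cases ?_ (fun j => ?_) j
        · rw [Fin.castSucc_zero, Fin.cons_zero, Fin.cons_succ]
          rwa [show i = 0 from Fin.ext hi] at hxi
        · rw [← Fin.succ_castSucc, Fin.cons_succ, Fin.cons_succ]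
          exact hadj j
    · rcases Nat.lt_or_ge i d with hid | hid
      -- An interior member already has two neighbours in the chain; a third would force these two
      -- to coincide by `Adjacent.add_eq`.
      · obtain ⟨i, hi'⟩ := i
        obtain ⟨i, rfl⟩ : ∃ k, i = k + 1 := ⟨i - 1, by simp only at hi; omega⟩
        have h1 := hxi.add_eq (hadj' i (by simp only at hid; omega)) (hne _).symm
        have h2 := hxi.add_eq (hadj' (i + 1) hid).symm (hne _).symm
        have h3 := Fin.val_eq_of_eq (hinj (add_left_cancel (h1.trans h2.symm)))
        simp only at h3
        omega
      · apply hPd'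
        have hil : i = Fin.last d := Fin.ext (by simp; omega)
        refine ⟨Fin.snoc θ x, Fin.snoc_injective_iff.2 ⟨hinj, fun ⟨j, hj⟩ => hne j hj⟩, ?_, ?_⟩
        · intro j
          refine Fin.lastCases ?_ (fun j => ?_) j
          · simpa using hx
          · simpa using heig j
        · intro j
          refine Fin.lastCases ?_ (fun j => ?_) j
          · rw [Fin.succ_last, Fin.snoc_last, Fin.snoc_castSucc]
            exact (hil ▸ hxi).symm
          · rw [Fin.succ_castSucc, Fin.snoc_castSucc, Fin.snoc_castSucc]
            exact hadj j
  have hW := h.irreducible (⨆ i, A.eigenspace (θ i)) (fun v hv => by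
    have : (⨆ i, A.eigenspace (θ i)) ≤ (⨆ i, A.eigenspace (θ i)).comap A := by
      refine iSup_le fun i w hw => ?_
      rw [Submodule.mem_comap, Module.End.mem_eigenspace_iff.1 hw]
      exact Submodule.smul_mem _ _ (Submodule.mem_iSup_of_mem i hw)
    exact this hv) (fun v hv => by
    have : (⨆ i, A.eigenspace (θ i)) ≤ (⨆ i, A.eigenspace (θ i)).comap B := by
      refine iSup_le fun i w hw => ?_
      refine (iSup₂_le fun x hx => ?_ : _ ≤ ⨆ i, A.eigenspace (θ i)) (h.map_mem_adjacent hq0 hw)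
      by_cases hb : A.eigenspace x = ⊥
      · rw [hb]; exact bot_le
      · obtain ⟨j, rfl⟩ : ∃ j, θ j = x := by
          rcases hx with rfl | hx
          · exact ⟨i, rfl⟩
          · exact hclosed x hb i hx
        exact le_iSup (fun i => A.eigenspace (θ i)) j
    exact this hv)
  have htop : ⨆ i, A.eigenspace (θ i) = ⊤ := by
    refine hW.resolve_left fun hb => heig 0 ?_
    exact iSup_eq_bot.1 hb 0
  refine ⟨d, θ, hinj, Set.eq_of_subset_of_subset ?_ ?_, hadj⟩
  · rintro _ ⟨i, rfl⟩
    exact heig i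
  · intro x hx
    by_contra hne
    refine hx ?_
    have h1 := A.eigenspaces_iSupIndep x
    refine le_bot_iff.1 (h1 le_rfl ?_)
    refine le_trans le_top (htop ▸ iSup_le fun i => ?_)
    exact le_iSup₂_of_le (θ i) (fun e => hne ⟨i, e⟩) le_rfl

end IsOnsagerPair

end OnsagerPair

/-! ### Tridiagonal action in a standard ordering. -/

section Orderings

variable {F V : Type*} [Field F] [AddCommGroup V] [Module F V]

theorem IsStandardOrdering.rev {q : F} {A : End F V} {d : ℕ} {θ : Fin (d + 1) → F}
    (h : IsStandardOrdering q A θ) : IsStandardOrdering q A (fun i => θ i.rev) := by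
  refine ⟨h.1.comp Fin.rev_injective, ?_, fun i => ?_⟩
  · rw [← h.2.1]
    exact Fin.revPerm.surjective.range_comp θ
  · have := (h.2.2 i.rev).symm
    simp only [Fin.rev_castSucc, Fin.rev_succ]
    exact this

theorem IsStandardOrdering.isDecomposition {q : F} {A : End F V} (hA : IsDiagonalizable A)
    {d : ℕ} {θ : Fin (d + 1) → F} (h : IsStandardOrdering q A θ)
    {D : Fin (d + 1) → Submodule F V} (hD : ∀ i, D i = A.eigenspace (θ i)) :
    IsDecomposition D := by
  obtain rfl : D = fun i => A.eigenspace (θ i) := funext hD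
  refine ⟨?_, fun i => ?_⟩
  · rw [DirectSum.isInternal_submodule_iff_iSupIndep_and_iSup_eq_top]
    refine ⟨A.eigenspaces_iSupIndep.comp h.1, top_le_iff.1 ?_⟩
    rw [← hA]
    refine iSup_le fun x => ?_
    by_cases hx : A.eigenspace x = ⊥
    · rw [hx]; exact bot_le
    · obtain ⟨i, rfl⟩ : x ∈ Set.range θ := by rw [h.2.1]; exact hx
      exact le_iSup (fun i => A.eigenspace (θ i)) i
  · have : θ i ∈ {x | A.HasEigenvalue x} := h.2.1 ▸ Set.mem_range_self i
    exact this

theorem exists_nat_extension {α : Type*} {d : ℕ} (θ : Fin (d + 1) → α) :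
    ∃ r : ℕ → α, ∀ i : Fin (d + 1), r i = θ i :=
  ⟨fun n => θ ⟨min n d, by omega⟩, fun i => congrArg θ (Fin.ext (min_eq_left (Nat.le_of_lt_succ i.2)))⟩

namespace IsOnsagerPair

variable {q : F} {A B : End F V}

/-- With one eigenvalue `A` is a scalar, so an eigenvector of `B` spans an invariant line. -/
theorem ordering_pos [FiniteDimensional F V] (h : IsOnsagerPair q A B) {d : ℕ}
    {θ : Fin (d + 1) → F} (hθ : IsStandardOrdering q A θ) : 0 < d := by
  rcases Nat.eq_zero_or_pos d with rfl | hd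
  · exfalso
    have hD := hθ.isDecomposition h.diag₁ (fun i => rfl)
    have hA : ∀ v, A v = θ 0 • v := fun v => by
      have h1 : v ∈ ⨆ i, A.eigenspace (θ i) := by rw [hD.iSup_eq_top]; trivial
      have h2 : ⨆ i, A.eigenspace (θ i) ≤ A.eigenspace (θ 0) :=
        iSup_le fun i => by rw [Subsingleton.elim (α := Fin 1) i 0]
      exact Module.End.mem_eigenspace_iff.1 (h2 h1)
    obtain ⟨μ, hμ⟩ := h.symm.exists_hasEigenvalue
    obtain ⟨v, hv⟩ := hμ.exists_hasEigenvector
    have h1 := h.irreducible (F ∙ v) (fun w hw => by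
      rw [hA]; exact Submodule.smul_mem _ _ hw) (fun w hw => by
      obtain ⟨c, rfl⟩ := Submodule.mem_span_singleton.1 hw
      rw [map_smul, hv.apply_eq_smul, smul_comm]
      exact Submodule.smul_mem _ _ hw)
    have h2 := h.two_le
    rcases h1 with h1 | h1
    · exact hv.2 (Submodule.span_singleton_eq_bot.1 h1)
    · rw [← finrank_top F V, ← h1, finrank_span_singleton hv.2] at h2
      omega
  · exact hd

theorem exists_eq_rho [FiniteDimensional F V] (hq0 : q ≠ 0) (hq : ∀ n : ℕ, 0 < n → q ^ n ≠ 1)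
    (h : IsOnsagerPair q A B) {d : ℕ} {θ : Fin (d + 1) → F} (hθ : IsStandardOrdering q A θ) :
    ∃ a : F, a ≠ 0 ∧ a - a⁻¹ ≠ 0 ∧ (∀ i : Fin (d + 1), θ i = rho q d a⁻¹ i) ∧
      ∀ i ≤ d, ∀ j ≤ d, rho q d a⁻¹ i = rho q d a⁻¹ j → i = j := by
  have hd := h.ordering_pos hθ
  obtain ⟨a, ha, hr⟩ := _root_.exists_eq_rho hq0 hq hd hθ.1 hθ.2.2
  have hinj : ∀ i ≤ d, ∀ j ≤ d, rho q d a⁻¹ i = rho q d a⁻¹ j → i = j := by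
    intro i hi j hj e
    rw [← hr ⟨i, by omega⟩, ← hr ⟨j, by omega⟩] at e
    exact Fin.val_eq_of_eq (hθ.1 e)
  refine ⟨a, ha, fun h0 => ?_, hr, hinj⟩
  -- If a = a⁻¹, the first and last eigenvalues coincide, although `d` is positive.
  have h1 : rho q d a⁻¹ (d - 0) = rho q d a⁻¹ 0 := by
    rw [rho_sub q _ (Nat.zero_le d), inv_inv, ← sub_eq_zero.1 h0]
  have := hinj _ (by omega) _ (by omega) h1
  omega

theorem map_mem_near [FiniteDimensional F V] (hq0 : q ≠ 0) (hq : ∀ n : ℕ, 0 < n → q ^ n ≠ 1)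
    (h : IsOnsagerPair q A B) {d : ℕ} {θ : Fin (d + 1) → F} (hθ : IsStandardOrdering q A θ)
    {D : Fin (d + 1) → Submodule F V} (hD : ∀ i, D i = A.eigenspace (θ i)) {j : Fin (d + 1)}
    {v : V} (hv : v ∈ D j) :
    B v ∈ ⨆ i : Fin (d + 1), ⨆ _ : (i : ℕ) ≤ j + 1 ∧ (j : ℕ) ≤ i + 1, D i := by
  obtain ⟨a, ha, -, hr, hinj⟩ := h.exists_eq_rho hq0 hq hθ
  rw [hD] at hv
  refine (iSup₂_le fun x hx => ?_ : _ ≤ ⨆ i : Fin (d + 1), ⨆ _ : (i : ℕ) ≤ j + 1 ∧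
    (j : ℕ) ≤ i + 1, D i) (h.map_mem_adjacent hq0 hv)
  by_cases hb : A.eigenspace x = ⊥
  · rw [hb]; exact bot_le
  obtain ⟨i, rfl⟩ : x ∈ Set.range θ := by rw [hθ.2.1]; exact hb
  rw [← hD]
  refine le_iSup₂_of_le i ?_ le_rfl
  rcases hx with hx | hx
  · rw [hθ.1 hx]; omega
  · rw [hr, hr] at hx
    exact rho_adjacent hq0 hq (inv_ne_zero ha) hinj (by omega) (by omega) hx

theorem map_levelFlag [FiniteDimensional F V] (hq0 : q ≠ 0) (hq : ∀ n : ℕ, 0 < n → q ^ n ≠ 1)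
    (h : IsOnsagerPair q A B) {d : ℕ} {θ : Fin (d + 1) → F} (hθ : IsStandardOrdering q A θ)
    {D : Fin (d + 1) → Submodule F V} (hD : ∀ i, D i = A.eigenspace (θ i)) (n : ℕ) (v : V)
    (hv : v ∈ levelFlag D n) : B v ∈ levelFlag D (n + 1) := by
  have : levelFlag D n ≤ (levelFlag D (n + 1)).comap B := by
    refine iSup₂_le fun j hj w hw => ?_
    exact (iSup₂_le fun i hi => le_levelFlag D (by omega) : _ ≤ levelFlag D (n + 1))
      (h.map_mem_near hq0 hq hθ hD hw)
  exact this hv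

end IsOnsagerPair

end Orderings

/-! ### Oppositeness of the flags of A and A*. -/

section Split

variable {F V : Type*} [Field F] [AddCommGroup V] [Module F V]

/-- The sum of the intersections of two flags with indices adding up to `s`. -/
def antidiagonalSum (T R : ℕ → Submodule F V) (s : ℕ) : Submodule F V :=
  ⨆ n : ℕ, ⨆ m : ℕ, ⨆ _ : n + m = s, T n ⊓ R m

theorem le_antidiagonalSum (T R : ℕ → Submodule F V) {n m s : ℕ} (h : n + m = s) :
    T n ⊓ R m ≤ antidiagonalSum T R s :=
  le_iSup_of_le n (le_iSup_of_le m (le_iSup_of_le h le_rfl))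

variable {q : F} {A B : End F V}

/-- `A` minus its scalar on the quotient raises the `T`-index by one and lowers the `R`-index by
one, so their sum is kept. -/
theorem antidiagonalSum_map_mem {T R : ℕ → Submodule F V} {A : End F V} {r : ℕ → F}
    (hR0 : R 0 = ⊥) (hA : ∀ n, ∀ v ∈ T n, A v ∈ T (n + 1)) (hT : Monotone T)
    (hR : ActsOn R A r) {s : ℕ} {v : V} (hv : v ∈ antidiagonalSum T R s) :
    A v ∈ antidiagonalSum T R s := by
  have : antidiagonalSum T R s ≤ (antidiagonalSum T R s).comap A := by
    refine iSup_le fun n => iSup_le fun m => iSup_le fun h w hw => ?_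
    rw [Submodule.mem_comap]
    cases m with
    | zero =>
      have := hw.2
      rw [hR0] at this
      rw [(Submodule.mem_bot F).1 this, map_zero]
      exact zero_mem _
    | succ m =>
      have h1 : A w - r m • w ∈ T (n + 1) ⊓ R m :=
        ⟨sub_mem (hA n w hw.1) (Submodule.smul_mem _ _ (hT (Nat.le_succ n) hw.1)), hR m w hw.2⟩
      have h2 := add_mem (le_antidiagonalSum T R (s := s) (by omega) h1)
        (Submodule.smul_mem _ (r m) (le_antidiagonalSum T R h hw))
      simpa using h2
  exact this hv

theorem antidiagonalSum_comm (T R : ℕ → Submodule F V) (s : ℕ) :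
    antidiagonalSum T R s = antidiagonalSum R T s := by
  have : ∀ T R : ℕ → Submodule F V, antidiagonalSum T R s ≤ antidiagonalSum R T s :=
    fun T R => iSup_le fun n => iSup_le fun m => iSup_le fun h => by
      rw [inf_comm]; exact le_antidiagonalSum R T (by omega)
  exact le_antisymm (this _ _) (this _ _)

theorem IsOnsagerPair.antidiagonalSum_eq [FiniteDimensional F V] (hq0 : q ≠ 0)
    (hq : ∀ n : ℕ, 0 < n → q ^ n ≠ 1) (h : IsOnsagerPair q A B) {d e : ℕ}
    {θ : Fin (d + 1) → F} (hθ : IsStandardOrdering q A θ) {θs : Fin (e + 1) → F}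
    (hθs : IsStandardOrdering q B θs) {D : Fin (d + 1) → Submodule F V}
    (hD : ∀ i, D i = A.eigenspace (θ i)) {T : Fin (e + 1) → Submodule F V}
    (hT : ∀ i, T i = B.eigenspace (θs i)) (s : ℕ) :
    antidiagonalSum (levelFlag T) (levelFlag D) s = ⊥ ∨
      antidiagonalSum (levelFlag T) (levelFlag D) s = ⊤ := by
  obtain ⟨r, hr⟩ := exists_nat_extension θ
  obtain ⟨t, ht⟩ := exists_nat_extension θs
  refine h.irreducible _ (fun v hv => ?_) (fun v hv => ?_)
  · exact antidiagonalSum_map_mem (levelFlag_zero D) (h.symm.map_levelFlag hq0 hq hθs hT)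
      (levelFlag_mono T) (ActsOn.of_eigenspace (r := r) (hθ.isDecomposition h.diag₁ hD)
        fun i => by rw [hD, hr]) hv
  · rw [antidiagonalSum_comm] at hv ⊢
    exact antidiagonalSum_map_mem (levelFlag_zero T) (h.map_levelFlag hq0 hq hθ hD)
      (levelFlag_mono D) (ActsOn.of_eigenspace (r := t) (hθs.isDecomposition h.diag₂ hT)
        fun i => by rw [hT, ht]) hv

/-- For `n + m ≤ d + 1` every nonzero term of the antidiagonal sum lies in `levelFlag D d`, a proper
subspace; so the sum is not `⊤` and must be `⊥`. -/
theorem IsOnsagerPair.disjoint_levelFlag [FiniteDimensional F V] (hq0 : q ≠ 0)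
    (hq : ∀ n : ℕ, 0 < n → q ^ n ≠ 1) (h : IsOnsagerPair q A B) {d e : ℕ}
    {θ : Fin (d + 1) → F} (hθ : IsStandardOrdering q A θ) {θs : Fin (e + 1) → F}
    (hθs : IsStandardOrdering q B θs) {D : Fin (d + 1) → Submodule F V}
    (hD : ∀ i, D i = A.eigenspace (θ i)) {T : Fin (e + 1) → Submodule F V}
    (hT : ∀ i, T i = B.eigenspace (θs i)) (n m : ℕ) (hnm : n + m ≤ d + 1) :
    Disjoint (levelFlag T n) (levelFlag D m) := by
  have hDd := (hθ.isDecomposition h.diag₁ hD).isFlag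
  rw [disjoint_iff]
  rcases h.antidiagonalSum_eq hq0 hq hθ hθs hD hT (n + m) with h1 | h1
  · exact le_bot_iff.1 (h1 ▸ le_antidiagonalSum _ _ rfl)
  · exfalso
    refine hDd.strict d le_rfl ?_
    refine le_top.trans (h1 ▸ iSup_le fun k => iSup_le fun l => iSup_le fun hkl => ?_)
    rcases Nat.eq_zero_or_pos k with rfl | hk
    · rw [levelFlag_zero, bot_inf_eq]; exact bot_le
    · exact inf_le_right.trans (hDd.mono (by omega))

theorem IsOnsagerPair.length_le [FiniteDimensional F V] (hq0 : q ≠ 0)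
    (hq : ∀ n : ℕ, 0 < n → q ^ n ≠ 1) (h : IsOnsagerPair q A B) {d e : ℕ}
    {θ : Fin (d + 1) → F} (hθ : IsStandardOrdering q A θ) {θs : Fin (e + 1) → F}
    (hθs : IsStandardOrdering q B θs) : d ≤ e := by
  by_contra! hlt
  have hD := hθ.isDecomposition h.diag₁ (fun i => rfl)
  have hT := hθs.isDecomposition h.diag₂ (fun i => rfl)
  have h1 := h.disjoint_levelFlag hq0 hq hθ hθs (fun i => rfl) (fun i => rfl) (e + 1) 1 (by omega)
  rw [hT.isFlag.top, top_disjoint] at h1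
  exact hD.isFlag.strict 0 (Nat.zero_le d) (h1 ▸ bot_le)

/-- The antidiagonal sum with total `d + 2` contains the nonzero first step of the flag of `T`, so
it is `⊤`; its nonzero terms are the opposite intersections. -/
theorem IsOnsagerPair.iSup_oppositeInf [FiniteDimensional F V] (hq0 : q ≠ 0)
    (hq : ∀ n : ℕ, 0 < n → q ^ n ≠ 1) (h : IsOnsagerPair q A B) {d : ℕ}
    {θ : Fin (d + 1) → F} (hθ : IsStandardOrdering q A θ) {θs : Fin (d + 1) → F}
    (hθs : IsStandardOrdering q B θs) {D : Fin (d + 1) → Submodule F V}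
    (hD : ∀ i, D i = A.eigenspace (θ i)) {T : Fin (d + 1) → Submodule F V}
    (hT : ∀ i, T i = B.eigenspace (θs i)) :
    ⨆ i, oppositeInf d (levelFlag T) (levelFlag D) i = ⊤ := by
  have hDd := (hθ.isDecomposition h.diag₁ hD).isFlag
  have hTd := (hθs.isDecomposition h.diag₂ hT).isFlag
  rcases h.antidiagonalSum_eq hq0 hq hθ hθs hD hT (d + 2) with h1 | h1
  · exfalso
    have h2 := le_antidiagonalSum (levelFlag T) (levelFlag D) (show 1 + (d + 1) = d + 2 by omega)
    rw [h1, hDd.top, inf_top_eq] at h2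
    exact hTd.strict 0 (Nat.zero_le d) (h2.trans bot_le)
  · refine top_le_iff.1 (h1 ▸ iSup_le fun n => iSup_le fun m => iSup_le fun hnm => ?_)
    rcases Nat.eq_zero_or_pos n with rfl | hn
    · rw [levelFlag_zero, bot_inf_eq]; exact bot_le
    rcases Nat.eq_zero_or_pos m with rfl | hm
    · rw [levelFlag_zero, inf_bot_eq]; exact bot_le
    refine le_iSup_of_le (⟨n - 1, by omega⟩ : Fin (d + 1)) ?_
    simp only [oppositeInf]
    rw [show n - 1 + 1 = n by omega, show d + 1 - (n - 1) = m by omega]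

end Split

/-! ### The Lusztig automorphism as a conjugation. -/

section Lusztig

variable {F V : Type*} [Field F] [AddCommGroup V] [Module F V] {q : F} {A B : End F V}

/-- The inverse Lusztig automorphism is implemented by conjugation with a map that acts as a
scalar on the eigenspaces of `A`. -/
theorem IsOnsagerPair.exists_conj [FiniteDimensional F V] (hq0 : q ≠ 0)
    (hq : ∀ n : ℕ, 0 < n → q ^ n ≠ 1) (h : IsOnsagerPair q A B) {d : ℕ} {a : F} (ha : a ≠ 0)
    {θ : Fin (d + 1) → F} (hθ : IsStandardOrdering q A θ) {R : Fin (d + 1) → Submodule F V}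
    (hr : ∀ i : Fin (d + 1), θ i = rho q d a i) (hR : ∀ i, R i = A.eigenspace (θ i)) :
    ∃ (H H' : End F V) (τ : ℕ → F), H * H' = 1 ∧ H' * H = 1 ∧ H * A = A * H ∧ (∀ i, τ i ≠ 0) ∧
      (∀ i < d, τ (i + 1) = a ^ 2 * (wt q d (i + 1))⁻¹ * (wt q d i)⁻¹ * τ i) ∧
      (∀ i : Fin (d + 1), ∀ v ∈ R i, H v = τ i • v) ∧
      B + ((q - q⁻¹) * (q ^ 2 - (q ^ 2)⁻¹))⁻¹ • ⁅A, qComm q⁻¹ A B⁆ = H' * B * H := by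
  have hRd := hθ.isDecomposition h.diag₁ hR
  have hw := wt_ne_zero hq0 d
  obtain ⟨τ, hτdef⟩ : ∃ τ : ℕ → F, τ = fun n =>
      ∏ k ∈ Finset.range n, (a ^ 2 * (wt q d (k + 1))⁻¹ * (wt q d k)⁻¹) := ⟨_, rfl⟩
  have hτ : ∀ i, τ (i + 1) = a ^ 2 * (wt q d (i + 1))⁻¹ * (wt q d i)⁻¹ * τ i := fun i => by
    rw [hτdef]
    simp only
    rw [Finset.prod_range_succ, mul_comm]
  have hτ0 : ∀ i, τ i ≠ 0 := fun i => by
    rw [hτdef]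
    exact Finset.prod_ne_zero_iff.2 fun k _ => mul_ne_zero (mul_ne_zero (pow_ne_zero 2 ha)
      (inv_ne_zero (hw _))) (inv_ne_zero (hw _))
  obtain ⟨H, hH⟩ := exists_map_of_isInternal hRd.1 (fun i => τ i)
  obtain ⟨H', hH'⟩ := exists_map_of_isInternal hRd.1 (fun i => (τ i)⁻¹)
  have hA : ∀ i, ∀ v ∈ R i, A v = rho q d a i • v := fun i v hv => by
    rw [hR, Module.End.mem_eigenspace_iff, hr] at hv
    exact hv
  have hH1 : H * H' = 1 := map_ext_of_iSup_eq_top hRd.iSup_eq_top fun i v hv => by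
    rw [Module.End.mul_apply, hH' i v hv, map_smul, hH i v hv, smul_smul,
      inv_mul_cancel₀ (hτ0 i), one_smul, Module.End.one_apply]
  have hH2 : H' * H = 1 := map_ext_of_iSup_eq_top hRd.iSup_eq_top fun i v hv => by
    rw [Module.End.mul_apply, hH i v hv, map_smul, hH' i v hv, smul_smul,
      mul_inv_cancel₀ (hτ0 i), one_smul, Module.End.one_apply]
  have hHA : H * A = A * H := map_ext_of_iSup_eq_top hRd.iSup_eq_top fun i v hv => by
    rw [Module.End.mul_apply, Module.End.mul_apply, hA i v hv, hH i v hv, map_smul, map_smul,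
      hA i v hv, hH i v hv, smul_comm]
  refine ⟨H, H', τ, hH1, hH2, hHA, hτ0, fun i _ => hτ i, hH, ?_⟩
  have hqq := sub_inv_ne_zero hq0 hq
  have hq4 : q ^ 2 - (q ^ 2)⁻¹ ≠ 0 :=
    sub_inv_ne_zero (q := q ^ 2) (pow_ne_zero 2 hq0) fun n hn => by
      rw [← pow_mul]; exact hq _ (by omega)
  obtain ⟨c, hc⟩ : ∃ c, c = (q - q⁻¹) * (q ^ 2 - (q ^ 2)⁻¹) := ⟨_, rfl⟩
  have hc0 : c ≠ 0 := hc ▸ mul_ne_zero hqq hq4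
  -- With ρ for the eigenvalues, the double commutator multiplies the block of `B` from eigenspace j
  -- to eigenspace i by (ρᵢ - ρⱼ)(q⁻¹ρᵢ - qρⱼ). For neighbours the total factor is τⱼ/τᵢ, as
  -- conjugation by `H` requires.
  have hnext : ∀ i, c + (rho q d a (i + 1) - rho q d a i) *
      (q⁻¹ * rho q d a (i + 1) - q * rho q d a i) = c * (τ i * (τ (i + 1))⁻¹) := fun i => by
    have h1 := hw i
    have h2 := hτ0 i
    rw [hτ, hc]
    simp only [rho, wt_succ hq0]
    field_simp
    ring
  have hprev : ∀ i, c + (rho q d a i - rho q d a (i + 1)) *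
      (q⁻¹ * rho q d a i - q * rho q d a (i + 1)) = c * (τ (i + 1) * (τ i)⁻¹) := fun i => by
    have h1 := hw i
    have h2 := hτ0 i
    rw [hτ, hc]
    simp only [rho, wt_succ hq0]
    field_simp
    ring
  rw [← hc]
  have key : H * (B + c⁻¹ • ⁅A, qComm q⁻¹ A B⁆) = B * H := by
    refine map_ext_of_iSup_eq_top hRd.iSup_eq_top fun j v hv => ?_
    obtain ⟨N, hN⟩ : ∃ N : End F V, N = H * (1 + c⁻¹ • ((A - rho q d a j • 1) *
      (q⁻¹ • A - (q * rho q d a j) • 1))) - τ j • 1 := ⟨_, rfl⟩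
    have hNv : (H * (B + c⁻¹ • ⁅A, qComm q⁻¹ A B⁆)) v - (B * H) v = N (B v) := by
      rw [hN]
      simp only [Module.End.mul_apply, LinearMap.add_apply, LinearMap.sub_apply,
        LinearMap.smul_apply, Module.End.one_apply, Ring.lie_def, qComm, hA j v hv, hH j v hv,
        map_smul, map_sub, map_add, inv_inv]
      match_scalars <;> ring
    have hN0 : (⨆ i : Fin (d + 1), ⨆ _ : (i : ℕ) ≤ j + 1 ∧ (j : ℕ) ≤ i + 1, R i) ≤
        LinearMap.ker N := by
      refine iSup₂_le fun i hi w hw => ?_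
      have hNw : N w = (c⁻¹ * (c + (rho q d a i - rho q d a j) *
          (q⁻¹ * rho q d a i - q * rho q d a j)) * τ i - τ j) • w := by
        rw [hN]
        simp only [Module.End.mul_apply, LinearMap.add_apply, LinearMap.sub_apply,
          LinearMap.smul_apply, Module.End.one_apply, hA i w hw, hH i w hw, map_smul, map_sub,
          map_add]
        match_scalars
        field_simp
      rw [LinearMap.mem_ker, hNw]
      obtain ⟨h1, h2⟩ := hi
      have h3 := hτ0 i
      rcases Nat.lt_trichotomy i j with hij | hij | hij
      · rw [show (j : ℕ) = i + 1 by omega, hprev]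
        rw [← mul_assoc, inv_mul_cancel₀ hc0, one_mul, mul_assoc, inv_mul_cancel₀ h3, mul_one,
          sub_self, zero_smul]
      · rw [hij, sub_self, zero_mul, add_zero, inv_mul_cancel₀ hc0, one_mul, sub_self, zero_smul]
      · rw [show (i : ℕ) = j + 1 by omega] at h3 ⊢
        rw [hnext]
        rw [← mul_assoc, inv_mul_cancel₀ hc0, one_mul, mul_assoc, inv_mul_cancel₀ h3, mul_one,
          sub_self, zero_smul]
    have := hN0 (h.map_mem_near hq0 hq hθ hR hv)
    rw [LinearMap.mem_ker, ← hNv] at this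
    exact sub_eq_zero.1 this
  rw [mul_assoc, ← key, ← mul_assoc, hH2, one_mul]

end Lusztig

/-! ### Edges in terms of diagonal actions, and transport by conjugation. -/

section Diagram

variable {F V : Type*} [Field F] [AddCommGroup V] [Module F V]

/-- The decomposition whose flag is attached to a vertex of the diagram. -/
def vertexDecomposition {d : ℕ} (VA VAs VLi : Fin (d + 1) → Submodule F V) :
    DVertex → Fin (d + 1) → Submodule F V
  | .topL => VAs
  | .topR => inversion VAs
  | .midL => VA
  | .midR => inversion VA
  | .botL => VLi
  | .botR => inversion VLi

theorem isSegment_iff_joins {d : ℕ} {VA VAs VLi : Fin (d + 1) → Submodule F V} {u v : DVertex}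
    {W : Fin (d + 1) → Submodule F V} :
    IsSegment VA VAs VLi u v W ↔
      Joins (vertexDecomposition VA VAs VLi u) (vertexDecomposition VA VAs VLi v) W := by
  have : ∀ u, vertexFlag VA VAs VLi u = partialSum (vertexDecomposition VA VAs VLi u) := by
    intro u; cases u <;> rfl
  rw [IsSegment, this, this, Joins]

theorem isSegmentMap_of_actsOn {q : F} (hq0 : q ≠ 0) (hq : ∀ n : ℕ, 0 < n → q ^ n ≠ 1) {d : ℕ}
    {VA VAs VLi : Fin (d + 1) → Submodule F V} (hA : IsDecomposition VA)
    (hAs : IsDecomposition VAs) (hLi : IsDecomposition VLi) (u v : DVertex) {M : End F V}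
    (h : ActsOn (levelFlag (vertexDecomposition VA VAs VLi u)) M (wt q d) ∧
      ActsOn (levelFlag (vertexDecomposition VA VAs VLi v)) M (fun i => (wt q d i)⁻¹)) :
    IsSegmentMap q VA VAs VLi u v M := by
  have hD : ∀ u, IsDecomposition (vertexDecomposition VA VAs VLi u) := by
    intro u
    cases u
    exacts [hAs, hAs.inversion, hA, hA.inversion, hLi, hLi.inversion]
  exact ⟨_, isSegment_iff_joins.2 (joins_eigenspace hq0 hq (hD u) (hD v) h.1 h.2),
    eigenspace_isCorrespondingMap q d M⟩

theorem IsSegment.eq {d : ℕ} {VA VAs VLi : Fin (d + 1) → Submodule F V} {u v : DVertex}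
    {W W' : Fin (d + 1) → Submodule F V} (h : IsSegment VA VAs VLi u v W)
    (h' : IsSegment VA VAs VLi u v W') : W = W' :=
  (isSegment_iff_joins.1 h).eq_oppositeInf.trans (isSegment_iff_joins.1 h').eq_oppositeInf.symm

theorem IsSegmentMap.eq {q : F} {d : ℕ} {VA VAs VLi : Fin (d + 1) → Submodule F V}
    {u v : DVertex} {M M' : End F V} (h : IsSegmentMap q VA VAs VLi u v M)
    (h' : IsSegmentMap q VA VAs VLi u v M') : M = M' := by
  obtain ⟨W, hW, hM⟩ := h
  obtain ⟨W', hW', hM'⟩ := h'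
  obtain rfl := hW.eq hW'
  exact map_ext_of_iSup_eq_top hW.1.iSup_eq_top fun i w hw => by rw [hM i w hw, hM' i w hw]

theorem IsEquitableTriple.rotate {q : F} {X Y Z : End F V} (h : IsEquitableTriple q X Y Z) :
    IsEquitableTriple q Y Z X :=
  ⟨h.2.1, h.2.2.1, h.1, h.2.2.2.2.1, h.2.2.2.2.2, h.2.2.2.1⟩

theorem eigenspace_conj {A H H' : End F V} (hH1 : H * H' = 1) (hH2 : H' * H = 1) (μ : F) :
    (H' * A * H).eigenspace μ = (A.eigenspace μ).map H' := by
  have e1 : ∀ v, H (H' v) = v := fun v => by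
    rw [← Module.End.mul_apply, hH1, Module.End.one_apply]
  have e2 : ∀ v, H' (H v) = v := fun v => by
    rw [← Module.End.mul_apply, hH2, Module.End.one_apply]
  ext v
  rw [Module.End.mem_eigenspace_iff, Submodule.mem_map]
  constructor
  · intro hv
    refine ⟨H v, ?_, e2 v⟩
    rw [Module.End.mem_eigenspace_iff, ← map_smul, ← hv]
    simp only [Module.End.mul_apply, e1]
  · rintro ⟨w, hw, rfl⟩
    rw [Module.End.mem_eigenspace_iff] at hw
    simp only [Module.End.mul_apply, e1, hw, map_smul]

theorem levelFlag_map {d : ℕ} (W : Fin (d + 1) → Submodule F V) (f : End F V) (n : ℕ) :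
    levelFlag (fun i => (W i).map f) n = (levelFlag W n).map f := by
  simp only [levelFlag, Submodule.map_iSup]

theorem IsDecomposition.map {d : ℕ} {W : Fin (d + 1) → Submodule F V} (h : IsDecomposition W)
    {f g : End F V} (hgf : g * f = 1) (hfg : f * g = 1) :
    IsDecomposition (fun i => (W i).map f) := by
  have e1 : ∀ v, g (f v) = v := fun v => by
    rw [← Module.End.mul_apply, hgf, Module.End.one_apply]
  have e2 : ∀ v, f (g v) = v := fun v => by
    rw [← Module.End.mul_apply, hfg, Module.End.one_apply]
  have hf : Function.Injective f := Function.LeftInverse.injective e1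
  refine ⟨?_, fun i hi => h.2 i
    (Submodule.map_injective_of_injective hf (hi.trans (Submodule.map_bot f).symm))⟩
  rw [DirectSum.isInternal_submodule_iff_iSupIndep_and_iSup_eq_top]
  refine ⟨?_, ?_⟩
  · intro i
    have := h.1.submodule_iSupIndep i
    have h2 := Submodule.disjoint_map hf this
    simpa only [Submodule.map_iSup] using h2
  · rw [← Submodule.map_iSup, h.iSup_eq_top, Submodule.map_top, LinearMap.range_eq_top]
    exact Function.RightInverse.surjective e2

end Diagram

/-! ### From modules over the q-Onsager algebra to pairs of maps. -/

section QOnsagerModule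

variable {F : Type*} [Field F] {q : F}

theorem QOnsager.dolanGrady₂ (q : F) :
    ⁅QOnsager.Astar q, qComm q⁻¹ (QOnsager.Astar q) (qComm q (QOnsager.Astar q) (QOnsager.A q))⁆ =
      (q ^ 2 - (q ^ 2)⁻¹) ^ 2 • ⁅QOnsager.A q, QOnsager.Astar q⁆ := by
  have h := RingQuot.mkAlgHom_rel F (DolanGrady.dg2 (q := q))
  simpa only [qComm, Ring.lie_def, map_sub, map_mul, map_smul, QOnsager.A, QOnsager.Astar] using h

theorem AlgHom.map_qComm {R S : Type*} [Ring R] [Algebra F R] [Ring S] [Algebra F S]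
    (f : R →ₐ[F] S) (x y : R) : f (qComm q x y) = qComm q (f x) (f y) := by
  simp only [qComm, map_sub, map_smul, map_mul]

theorem AlgHom.map_ringLie {R S : Type*} [Ring R] [Algebra F R] [Ring S] [Algebra F S]
    (f : R →ₐ[F] S) (x y : R) : f ⁅x, y⁆ = ⁅f x, f y⁆ := by
  simp only [Ring.lie_def, map_sub, map_mul]

variable {V : Type*} [AddCommGroup V] [Module F V] [Module (QOnsager q) V]
  [IsScalarTower F (QOnsager q) V]

/-- A subspace stable under both generators is stable under the `q`-Onsager algebra. -/
theorem QOnsager.smul_mem (W : Submodule F V) (h1 : ∀ v ∈ W, QOnsager.A q • v ∈ W)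
    (h2 : ∀ v ∈ W, QOnsager.Astar q • v ∈ W) (x : QOnsager q) {v : V} (hv : v ∈ W) :
    x • v ∈ W := by
  obtain ⟨y, rfl⟩ := RingQuot.mkAlgHom_surjective F (DolanGrady q) x
  induction y using FreeAlgebra.induction generalizing v with
  | grade0 r =>
    rw [AlgHom.commutes, algebraMap_smul]
    exact W.smul_mem r hv
  | grade1 g =>
    cases g
    exacts [h1 v hv, h2 v hv]
  | mul a b ha hb =>
    rw [map_mul, mul_smul]
    exact ha (hb hv)
  | add a b ha hb =>
    rw [map_add, add_smul]
    exact W.add_mem (ha hv) (hb hv)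

theorem QOnsager.isOnsagerPair [IsSimpleModule (QOnsager q) V] (hdim : 2 ≤ finrank F V)
    (hdA : IsDiagonalizable (Algebra.lsmul F F V (QOnsager.A q)))
    (hdAs : IsDiagonalizable (Algebra.lsmul F F V (QOnsager.Astar q))) :
    IsOnsagerPair q (Algebra.lsmul F F V (QOnsager.A q) : End F V)
      (Algebra.lsmul F F V (QOnsager.Astar q)) where
  rel₁ := by
    have := congrArg (Algebra.lsmul F F V) (QOnsager.dolanGrady₁ q)
    simpa only [AlgHom.map_ringLie, AlgHom.map_qComm, map_smul] using this
  rel₂ := by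
    have := congrArg (Algebra.lsmul F F V) (QOnsager.dolanGrady₂ q)
    simpa only [AlgHom.map_ringLie, AlgHom.map_qComm, map_smul] using this
  irreducible W h1 h2 := by
    let W' : Submodule (QOnsager q) V :=
      { W with smul_mem' := fun x v hv => QOnsager.smul_mem W h1 h2 x hv }
    have hmem : ∀ v, v ∈ W' ↔ v ∈ W := fun v => Iff.rfl
    rcases eq_bot_or_eq_top W' with h | h
    · left
      ext v
      rw [← hmem, h, Submodule.mem_bot, Submodule.mem_bot]
    · right
      ext v
      rw [← hmem, h]
      exact ⟨fun _ => trivial, fun _ => trivial⟩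
  diag₁ := hdA
  diag₂ := hdAs
  two_le := hdim

end QOnsagerModule

/-! ### The main theorem. -/

theorem theorem8p4 {F : Type*} [Field F] (q : F) (hq0 : q ≠ 0) (hq : ∀ n : ℕ, 0 < n → q ^ n ≠ 1)
    {V : Type*} [AddCommGroup V] [Module F V] [Module (QOnsager q) V]
    [IsScalarTower F (QOnsager q) V] [FiniteDimensional F V]
    [IsSimpleModule (QOnsager q) V] (hdim : 2 ≤ finrank F V)
    (A As Li : End F V)
    (hA : A = Algebra.lsmul F F V (QOnsager.A q))
    (hAs : As = Algebra.lsmul F F V (QOnsager.Astar q))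
    (hLi : Li = Algebra.lsmul F F V (QOnsager.LinvAstar q))
    (hdA : IsDiagonalizable A) (hdAs : IsDiagonalizable As) :
    -- the eigenvalues of `A` and of `A*` admit standard orderings, of the same length `d + 1`
    (∃ (d : ℕ) (θ θs : Fin (d + 1) → F),
      IsStandardOrdering q A θ ∧ IsStandardOrdering q As θs) ∧
    ∀ (d : ℕ) (θ θs : Fin (d + 1) → F) (VA VAs VLi : Fin (d + 1) → Submodule F V),
      IsStandardOrdering q A θ → IsStandardOrdering q As θs →
      (∀ i, VA i = A.eigenspace (θ i)) → (∀ i, VAs i = As.eigenspace (θs i)) →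
      (∀ i, VLi i = Li.eigenspace (θs i)) →
      -- the horizontal segments and the oriented edges of the diagram are well defined
      IsDecomposition VA ∧ IsDecomposition VAs ∧ IsDecomposition VLi ∧
      (∀ u v, DEdge u v → ∃! W, IsSegment VA VAs VLi u v W) ∧
      -- the maps along each oriented 3-cycle form an equitable triple
      (∀ u v w, DEdge u v → DEdge v w → DEdge w u → ∀ X Y Z : End F V,
        IsSegmentMap q VA VAs VLi u v X → IsSegmentMap q VA VAs VLi v w Y →
        IsSegmentMap q VA VAs VLi w u Z → IsEquitableTriple q X Y Z) ∧
      -- the maps on the ten oriented edges, and the resulting four equitable triples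
      ∃ (a : F) (K B Kd Bd M Md : End F V),
        a ≠ 0 ∧ a - a⁻¹ ≠ 0 ∧
        (∀ i, θ i = a * q ^ ((d : ℤ) - 2 * (i : ℤ)) + a⁻¹ * q ^ (2 * (i : ℤ) - (d : ℤ))) ∧
        M = (a - a⁻¹)⁻¹ • (a • K - a⁻¹ • B) ∧ Md = (a - a⁻¹)⁻¹ • (a • Kd - a⁻¹ • Bd) ∧
        IsUnit M ∧ IsUnit Md ∧
        IsSegmentMap q VA VAs VLi .topL .midR K ∧
        IsSegmentMap q VA VAs VLi .topL .midL B ∧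
        IsSegmentMap q VA VAs VLi .topR .midR Kd ∧
        IsSegmentMap q VA VAs VLi .topR .midL Bd ∧
        IsSegmentMap q VA VAs VLi .midR .botL (a • A - a ^ 2 • K) ∧
        IsSegmentMap q VA VAs VLi .midL .botL (a⁻¹ • A - (a ^ 2)⁻¹ • B) ∧
        IsSegmentMap q VA VAs VLi .midR .botR (a • A - a ^ 2 • Kd) ∧
        IsSegmentMap q VA VAs VLi .midL .botR (a⁻¹ • A - (a ^ 2)⁻¹ • Bd) ∧
        IsSegmentMap q VA VAs VLi .botL .topL (Ring.inverse M) ∧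
        IsSegmentMap q VA VAs VLi .botR .topR (Ring.inverse Md) ∧
        IsEquitableTriple q (a • A - a ^ 2 • K) (Ring.inverse M) K ∧
        IsEquitableTriple q (a⁻¹ • A - (a ^ 2)⁻¹ • B) (Ring.inverse M) B ∧
        IsEquitableTriple q (a • A - a ^ 2 • Kd) (Ring.inverse Md) Kd ∧
        IsEquitableTriple q (a⁻¹ • A - (a ^ 2)⁻¹ • Bd) (Ring.inverse Md) Bd := by
  have hp : IsOnsagerPair q A As := by
    subst hA hAs
    exact QOnsager.isOnsagerPair hdim hdA hdAs
  have hLi' : Li = As + ((q - q⁻¹) * (q ^ 2 - (q ^ 2)⁻¹))⁻¹ • ⁅A, qComm q⁻¹ A As⁆ := by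
    rw [hLi, hA, hAs, QOnsager.LinvAstar, map_add, map_smul, AlgHom.map_ringLie,
      AlgHom.map_qComm]
  refine ⟨?_, ?_⟩
  · obtain ⟨d, θ, hθ⟩ := hp.exists_isStandardOrdering hq0
    obtain ⟨e, θs, hθs⟩ := hp.symm.exists_isStandardOrdering hq0
    obtain rfl : d = e :=
      le_antisymm (hp.length_le hq0 hq hθ hθs) (hp.symm.length_le hq0 hq hθs hθ)
    exact ⟨d, θ, θs, hθ, hθs⟩
  intro d θ θs VA VAs VLi hθ hθs hVA hVAs hVLi
  have dA := hθ.isDecomposition hp.diag₁ hVA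
  have dAs := hθs.isDecomposition hp.diag₂ hVAs
  obtain ⟨a, ha, haa, hr, hinj⟩ := hp.exists_eq_rho hq0 hq hθ
  have hr' : ∀ i : Fin (d + 1), θ i.rev = rho q d a i := fun i => by
    rw [hr, Fin.val_rev, show d + 1 - ((i : ℕ) + 1) = d - i by omega, rho_sub q _ (by omega),
      inv_inv]
  have hinj' : ∀ i ≤ d, ∀ j ≤ d, rho q d a i = rho q d a j → i = j := by
    intro i hi j hj e
    rw [← inv_inv a, ← rho_sub q a⁻¹ hi, ← rho_sub q a⁻¹ hj] at e
    have := hinj _ (by omega) _ (by omega) e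
    omega
  have hRθ : ∀ i, inversion VA i = A.eigenspace (θ i.rev) := fun i => hVA _
  obtain ⟨H, H', τ, hH1, hH2, hHA, hτ0, hτ, hH, hconj⟩ :=
    hp.exists_conj hq0 hq ha hθ.rev hr' hRθ
  rw [← hLi'] at hconj
  have hVLi' : VLi = fun i => (VAs i).map H' := funext fun i => by
    rw [hVLi, hconj, eigenspace_conj hH1 hH2, hVAs]
  have dLi : IsDecomposition VLi := hVLi' ▸ dAs.map hH1 hH2
  -- `H` depends on the eigenspaces of `A` and on `a` only, so one `H` serves both top vertices.
  have main : ∀ (T S : Fin (d + 1) → Submodule F V) (θt : Fin (d + 1) → F),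
      IsStandardOrdering q As θt → (∀ i, T i = As.eigenspace (θt i)) → IsDecomposition S →
      (∀ n, levelFlag S n = (levelFlag T n).map H') → _ :=
    fun T S θt hθt hT hS hST => exists_edge_maps hq0 hq ha haa
      (hθt.isDecomposition hp.diag₂ hT) dA.inversion dA hS
      (fun i => by rw [hRθ, hr']) (fun i => by rw [hVA, hr]) hinj'
      (hp.symm.map_levelFlag hq0 hq hθt hT)
      (hp.disjoint_levelFlag hq0 hq hθ.rev hθt hRθ hT)
      (hp.iSup_oppositeInf hq0 hq hθ.rev hθt hRθ hT)
      (hp.disjoint_levelFlag hq0 hq hθ hθt hVA hT)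
      (hp.iSup_oppositeInf hq0 hq hθ hθt hVA hT)
      hH1 hH2 hHA hτ0 hτ hH (inversion_inversion VA).symm hST
  obtain ⟨K, B, M, hM, uM, sK, sB, sX, sX', sM, e1, e2⟩ := main VAs VLi θs hθs hVAs dLi
    (fun n => by rw [hVLi', levelFlag_map])
  obtain ⟨Kd, Bd, Md, hMd, uMd, sKd, sBd, sXd, sXd', sMd, e3, e4⟩ :=
    main (inversion VAs) (inversion VLi) (fun i => θs i.rev) hθs.rev (fun i => hVAs _)
      dLi.inversion (fun n => by rw [hVLi', ← levelFlag_map]; rfl)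
  have seg := fun u v {M : End F V} => isSegmentMap_of_actsOn hq0 hq dA dAs dLi u v (M := M)
  have gK := seg .topL .midR sK
  have gB := seg .topL .midL sB
  have gKd := seg .topR .midR sKd
  have gBd := seg .topR .midL sBd
  have gX := seg .midR .botL sX
  have gX' := seg .midL .botL sX'
  have gXd := seg .midR .botR sXd
  have gXd' := seg .midL .botR sXd'
  have gM := seg .botL .topL sM
  have gMd := seg .botR .topR sMd
  refine ⟨dA, dAs, dLi, ?_, ?_, a, K, B, Kd, Bd, M, Md, ha, haa, ?_, hM, hMd, uM, uMd, gK, gB,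
    gKd, gBd, gX, gX', gXd, gXd', gM, gMd, e1, e2, e3, e4⟩
  · intro u v huv
    obtain ⟨N, W, hW, -⟩ : ∃ N, IsSegmentMap q VA VAs VLi u v N := by
      cases huv
      exacts [⟨_, gB⟩, ⟨_, gK⟩, ⟨_, gBd⟩, ⟨_, gKd⟩, ⟨_, gX'⟩, ⟨_, gX⟩, ⟨_, gXd'⟩, ⟨_, gXd⟩,
        ⟨_, gM⟩, ⟨_, gMd⟩]
    exact ⟨W, hW, fun W' hW' => hW'.eq hW⟩
  · have tri : ∀ {u v w X' Y' Z'}, IsSegmentMap q VA VAs VLi u v X' →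
        IsSegmentMap q VA VAs VLi v w Y' → IsSegmentMap q VA VAs VLi w u Z' →
        IsEquitableTriple q X' Y' Z' → ∀ X Y Z : End F V, IsSegmentMap q VA VAs VLi u v X →
        IsSegmentMap q VA VAs VLi v w Y → IsSegmentMap q VA VAs VLi w u Z →
        IsEquitableTriple q X Y Z := by
      intro u v w X' Y' Z' hX' hY' hZ' he X Y Z hX hY hZ
      rwa [hX.eq hX', hY.eq hY', hZ.eq hZ']
    intro u v w huv hvw hwu
    -- Twelve cases survive: four 3-cycles, each with three starting vertices.
    cases huv <;> cases hvw <;> cases hwu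
    · exact tri gB gX' gM e2.rotate.rotate
    · exact tri gK gX gM e1.rotate.rotate
    · exact tri gBd gXd' gMd e4.rotate.rotate
    · exact tri gKd gXd gMd e3.rotate.rotate
    · exact tri gX' gM gB e2
    · exact tri gX gM gK e1
    · exact tri gXd' gMd gBd e4
    · exact tri gXd gMd gKd e3
    · exact tri gM gB gX' e2.rotate
    · exact tri gM gK gX e1.rotate
    · exact tri gMd gBd gXd' e4.rotate
    · exact tri gMd gKd gXd e3.rotate
  · intro i
    rw [hr, rho, inv_inv, wt, ← zpow_neg, neg_sub, add_comm]
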